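/- Let $\Bbbk$ be a field, let $m\ge 1$ and $n>k\ge 1$ be integers, and let $Q_{n,m}$ be the quiver with two vertices $1,2$, with $n$ arrows $c_1,\dots,c_n$ from $1$ to $2$ and $m$ arrows $b_1,\dots,b_m$ from $2$ to $1$. Let $C=\langle c_1,\dots,c_n\rangle$ and $B=\langle b_1,\dots,b_m\rangle$ be the spans of the arrows in the path algebra $\Bbbk Q_{n,m}$ (paths are composed from right to left, so that $c_j=e_2c_je_1$ and $b_i=e_1b_ie_2$). Let $\mathfrak F=\{V_1,\dots,V_m;W_1,\dots,W_m\}$ be any family of subspaces of $C$ with $\dim V_i=k$ and $\operatorname{codim} W_i=k$ for all $i$, and let $R_{\mathfrak F}$ be the quotient of $\Bbbk Q_{n,m}$ by the two-sided ideal generated by the relations (1) $bcb'=0$ for all $b,b'\in B$, $c\in C$; (2) $wb_i=0$ for all $w\in W_i$, $1\le i\le m$; (3) $b_iv=0$ for all $v\in V_i$, $1\le i\le m$. Let $\operatorname{perf}R_{\mathfrak F}$ be the full subcategory of the derived category of right $R_{\mathfrak F}$-modules consisting of the objects isomorphic to bounded complexes of finitely generated projective modules. Then: (a) $\operatorname{perf}R_{\mathfrak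 F}$ has no exceptional objects, i.e. there is no object $E$ with $\operatorname{Hom}(E,E[l])=0$ for all $l\neq 0$ and $\operatorname{Hom}(E,E)=\Bbbk$; (b) the Euler quadratic form of $R_{\mathfrak F}$ does not represent $1$: for every object $E$ of $\operatorname{perf}R_{\mathfrak F}$ the space $\bigoplus_{l\in\mathbb Z}\operatorname{Hom}(E,E[l])$ is finite-dimensional and $\chi(E,E)=\sum_l(-1)^l\dim_{\Bbbk}\operatorname{Hom}(E,E[l])\neq 1$. In particular, this holds for every such $\mathfrak F$ for which $R_{\mathfrak F}$ is smooth. -/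

import Mathlib

open CategoryTheory

universe w v u

noncomputable section

/-! ### The algebras `R_F` -/

namespace TwoVertex

/-- Generators of the path algebra of the quiver with two vertices `1`, `2`, with `n` arrows
`c_1, …, c_n` from `1` to `2` and `m` arrows `b_1, …, b_m` from `2` to `1`. -/
inductive Gen (n m : ℕ) : Type
  | e1 : Gen n m
  | e2 : Gen n m
  | c : Fin n → Gen n m
  | b : Fin m → Gen n m

/-- Relations of the path algebra: `e1`, `e2` are orthogonal idempotents with sum `1`, and
`e_{t(a)} a = a = a e_{s(a)}` for every arrow `a` (paths are composed from right to left). -/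
inductive PathRel (𝕜 : Type u) [Field 𝕜] (n m : ℕ) :
    FreeAlgebra 𝕜 (Gen n m) → FreeAlgebra 𝕜 (Gen n m) → Prop
  | e1_e1 : PathRel 𝕜 n m (.ι 𝕜 .e1 * .ι 𝕜 .e1) (.ι 𝕜 .e1)
  | e2_e2 : PathRel 𝕜 n m (.ι 𝕜 .e2 * .ι 𝕜 .e2) (.ι 𝕜 .e2)
  | e1_e2 : PathRel 𝕜 n m (.ι 𝕜 .e1 * .ι 𝕜 .e2) 0
  | e2_e1 : PathRel 𝕜 n m (.ι 𝕜 .e2 * .ι 𝕜 .e1) 0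
  | e1_add_e2 : PathRel 𝕜 n m (.ι 𝕜 .e1 + .ι 𝕜 .e2) 1
  | e2_c (j : Fin n) : PathRel 𝕜 n m (.ι 𝕜 .e2 * .ι 𝕜 (.c j)) (.ι 𝕜 (.c j))
  | c_e1 (j : Fin n) : PathRel 𝕜 n m (.ι 𝕜 (.c j) * .ι 𝕜 .e1) (.ι 𝕜 (.c j))
  | e1_b (i : Fin m) : PathRel 𝕜 n m (.ι 𝕜 .e1 * .ι 𝕜 (.b i)) (.ι 𝕜 (.b i))
  | b_e2 (i : Fin m) : PathRel 𝕜 n m (.ι 𝕜 (.b i) * .ι 𝕜 .e2) (.ι 𝕜 (.b i))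

/-- The path algebra of the quiver with two vertices, `n` arrows `1 → 2` and `m` arrows
`2 → 1`. -/
abbrev PathAlg (𝕜 : Type u) [Field 𝕜] (n m : ℕ) : Type u := RingQuot (PathRel 𝕜 n m)

variable {𝕜 : Type u} [Field 𝕜] {n m : ℕ}

/-- The image of a generator in the path algebra. -/
def gen (g : Gen n m) : PathAlg 𝕜 n m :=
  RingQuot.mkAlgHom 𝕜 (PathRel 𝕜 n m) (FreeAlgebra.ι 𝕜 g)

/-- The element `∑ j, x j • c_j` of the span `C` of the arrows `c_j`; this identifies `C` with
`Fin n → 𝕜`. -/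
def cElt (x : Fin n → 𝕜) : PathAlg 𝕜 n m := ∑ j, x j • gen (.c j)

/-- The element `∑ i, y i • b_i` of the span `B` of the arrows `b_i`. -/
def bElt (y : Fin m → 𝕜) : PathAlg 𝕜 n m := ∑ i, y i • gen (.b i)

/-- The relations defined by a family of subspaces `V_i`, `W_i` of `C`:
`b c b' = 0` for `b, b' ∈ B` and `c ∈ C`; `w b_i = 0` for `w ∈ W_i`; `b_i v = 0` for
`v ∈ V_i`. -/
inductive FamRel (V W : Fin m → Submodule 𝕜 (Fin n → 𝕜)) :
    PathAlg 𝕜 n m → PathAlg 𝕜 n m → Prop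
  | bcb (y : Fin m → 𝕜) (x : Fin n → 𝕜) (y' : Fin m → 𝕜) :
      FamRel V W (bElt y * cElt x * bElt y') 0
  | wb (i : Fin m) (x : Fin n → 𝕜) (hx : x ∈ W i) : FamRel V W (cElt x * gen (.b i)) 0
  | bv (i : Fin m) (x : Fin n → 𝕜) (hx : x ∈ V i) : FamRel V W (gen (.b i) * cElt x) 0

/-- The algebra `R_F`: the quotient of the path algebra by the two-sided ideal generated by the
relations of the family `F = (V_1, …, V_m; W_1, …, W_m)`. -/
abbrev RF (V W : Fin m → Submodule 𝕜 (Fin n → 𝕜)) : Type u := RingQuot (FamRel V W)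

end TwoVertex

/-! ### Perfect complexes, exceptional objects, the Euler form -/

/-- The category of right modules over `R`. -/
abbrev RightMod (R : Type u) [Ring R] := ModuleCat.{u} Rᵐᵒᵖ

/-- The perfect objects of the derived category `D(R)` of right `R`-modules: those isomorphic in
`D(R)` to a bounded complex of finitely generated projective modules. The triangulated category
`perf R` is the full subcategory of `D(R)` on these objects. -/
def perf (R : Type u) [Ring R] [HasDerivedCategory.{w} (RightMod R)] :
    ObjectProperty (DerivedCategory (RightMod R)) := fun E =>
  ∃ K : CochainComplex (RightMod R) ℤ,
    (∃ a b : ℤ, K.IsStrictlyGE a ∧ K.IsStrictlyLE b) ∧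
    (∀ i, Module.Finite Rᵐᵒᵖ (K.X i) ∧ Module.Projective Rᵐᵒᵖ (K.X i)) ∧
    Nonempty (E ≅ DerivedCategory.Q.obj K)

section

variable (𝕜 : Type u) [Field 𝕜] {T : Type v} [Category.{w} T] [Preadditive T] [Linear 𝕜 T]
  [HasShift T ℤ]

/-- An object `E` of a `𝕜`-linear category with shift is exceptional if `Hom(E, E[l]) = 0` for all
`l ≠ 0` and `Hom(E, E)` is one-dimensional (that is, `Hom(E, E) = 𝕜`). -/
def IsExceptional (E : T) : Prop :=
  (∀ l : ℤ, l ≠ 0 → Subsingleton (E ⟶ E⟦l⟧)) ∧ Module.finrank 𝕜 (E ⟶ E) = 1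

/-- The total space `⨁ l, Hom(E, F[l])` is finite-dimensional. -/
def FiniteTotalHom (E F : T) : Prop :=
  (∀ l : ℤ, Module.Finite 𝕜 (E ⟶ F⟦l⟧)) ∧ {l : ℤ | Nontrivial (E ⟶ F⟦l⟧)}.Finite

/-- The Euler form `χ(E, F) = ∑ l, (-1)^l dim Hom(E, F[l])` (meaningful when
`FiniteTotalHom 𝕜 E F` holds). -/
def eulerChar (E F : T) : ℤ :=
  ∑ᶠ l : ℤ, (l.negOnePow : ℤ) * (Module.finrank 𝕜 (E ⟶ F⟦l⟧) : ℤ)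

end

end

/-!
The Euler form of `E` in `perf R_F` is computed on a bounded complex `K` of finitely generated
projective modules representing `E`. Such a complex is K-projective, so `Hom(E, E[l])` is the
cohomology of the complex of cochains from `K` to itself (`cocycleToHom`), a bounded complex of
finite-dimensional spaces; hence `χ(E, E)` is the sum of the numbers `(-1)^(p+q) dim Hom(K^p, K^q)`
(`eulerChar_Q_obj`).

Modulo the nilpotent span of the paths of positive length, `R_F` is `𝕜 × 𝕜`. So every finitely
generated projective module is a sum of copies of the two modules `P_1 = e_1 R_F`, `P_2 = e_2 R_F`
(`IsSplitBasic.exists_multiplicity`), and `χ(E, E)` is a quadratic form in the two alternating sums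
of multiplicities, with coefficients given by the dimensions of the `e_i R_F e_j`. These are found
by writing down the modules `R_F e_1` and `R_F e_2` as explicit representations of the quiver
(`finrank_peirceComponent_of_section`). With `p = n - k` and `q = k` the form is
`(1 + m p) x² + (m + p + q + m p q) x y + (1 + m q) y²`.

This form does not represent `1` (`form_ne_one`). Put `A = 1 + m p`, `C = 1 + m q` and
`D = p + q + m p q`; then `A C - D m = 1`: the Euler bilinear form is unimodular. The form
has the automorphism with matrix `[[D, C], [-A, -m]]`, a square root, up to sign, of the
automorphism `S` given by `χ(u, v) = χ(v, S u)`. A descent along it brings a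
vector of value `1` into the cone between `(0, 1)` and its image `(C, -m)`. There the value
`1` is impossible: on the quadrant the nonzero values are at least `min A C`, and on the rest of the
cone one uses the identity `m (A X² - (D + m) X Y + C Y²) = (m X - C Y) (A X - m Y) + X Y`.

An exceptional object would have `χ(E, E) = 1`.
-/

noncomputable section

/-! ### The quadratic form does not represent `1` -/

/-- Values of the form on the part `C * Y ≤ m * X` of the fundamental domain. -/
theorem form_ne_one_of_le {A C D m X Y : ℤ} (hdet : A * C = 1 + D * m) (hm : 1 ≤ m)
    (hA : m + 1 ≤ A) (hC : m + 1 ≤ C) (hY : 0 < Y) (hXY : C * Y ≤ m * X) :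
    A * X ^ 2 - (D + m) * (X * Y) + C * Y ^ 2 ≠ 1 := by
  intro h
  have hlt : Y < X := by nlinarith
  have key : (m * X - C * Y) * (A * X - m * Y) + X * Y = m := by
    linear_combination m * h - X * Y * hdet
  rcases hXY.eq_or_lt with h0 | h0
  · have hX' : X = C * (A * X - D * Y) := by linear_combination -X * hdet + D * h0
    have hY' : Y = m * (A * X - D * Y) := by linear_combination -Y * hdet + A * h0
    set s := A * X - D * Y
    have hs : 1 ≤ s := by
      by_contra hs
      nlinarith
    have : C ≤ X := by nlinarith
    have : m ≤ Y := by nlinarith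
    have h1 : m * X - C * Y = 0 := by linarith
    rw [h1] at key
    nlinarith
  · have h1 : 1 ≤ m * X - C * Y := by linarith
    have h2 : m * 1 ≤ m * (X - Y) := by
      apply mul_le_mul_of_nonneg_left <;> linarith
    have h3 : (m + 1) * X ≤ A * X := by
      apply mul_le_mul_of_nonneg_right <;> linarith
    have h4 : A * X - m * Y ≤ (m * X - C * Y) * (A * X - m * Y) :=
      le_mul_of_one_le_left (by linarith) h1
    have h5 : 0 < X * Y := mul_pos (by linarith) hY
    linarith

/-- The automorphism `(X, -Y) ↦ (C * Y - m * X, -(D * Y - A * X))` of the form decreases `Y`, so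
the value `1` would have to be taken in a fundamental domain. -/
theorem form_ne_one_of_lt {A C D m : ℤ} (hdet : A * C = 1 + D * m) (hm : 1 ≤ m)
    (hA : m + 1 ≤ A) (hC : m + 1 ≤ C) (hD : m + 2 ≤ D) (N : ℕ) {X Y : ℤ} (hY : 0 < Y)
    (hYN : Y ≤ N) (hXY : (D + m) * Y < 2 * A * X) :
    A * X ^ 2 - (D + m) * (X * Y) + C * Y ^ 2 ≠ 1 := by
  induction N generalizing X Y with
  | zero => simp at hYN; omega
  | succ N ih =>
    intro h
    have hX : 0 < X := by
      by_contra hX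
      have : 0 < (D + m) * Y := mul_pos (by linarith) hY
      nlinarith
    rcases le_or_gt (C * Y) (m * X) with h0 | h0
    · exact form_ne_one_of_le hdet hm hA hC hY h0 h
    -- `r ^ 2` is `4 * A` plus the discriminant times `Y ^ 2`
    obtain ⟨r, hr⟩ : ∃ r, r = 2 * A * X - (D + m) * Y := ⟨_, rfl⟩
    have hr0 : 0 < r := by linarith
    obtain ⟨t, ht⟩ : ∃ t, t = D - m := ⟨_, rfl⟩
    have ht2 : 2 ≤ t := by linarith
    have hrr : r ^ 2 = 4 * A + (t ^ 2 - 4) * Y ^ 2 := by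
      rw [hr, ht]
      linear_combination 4 * A * h - 4 * Y ^ 2 * hdet
    obtain ⟨X', hX'⟩ : ∃ X', X' = C * Y - m * X := ⟨_, rfl⟩
    obtain ⟨Y', hY'⟩ : ∃ Y', Y' = D * Y - A * X := ⟨_, rfl⟩
    have hX'0 : 0 < X' := by linarith
    have h' : A * X' ^ 2 - (D + m) * (X' * Y') + C * Y' ^ 2 = 1 := by
      rw [hX', hY']
      linear_combination h + (A * X ^ 2 - (D + m) * (X * Y) + C * Y ^ 2) * hdet
    rcases le_or_gt Y' 0 with hY'0 | hY'0
    · have h1 : 0 ≤ X' * -Y' := mul_nonneg hX'0.le (by linarith)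
      have h2 : 0 ≤ (D + m) * (X' * -Y') := mul_nonneg (by linarith) h1
      nlinarith
    have h2Y' : 2 * Y' = t * Y - r := by rw [hY', hr, ht]; ring
    have hlt : Y' < Y := by
      have : (t - 2) * Y < r := by
        refine lt_of_pow_lt_pow_left₀ 2 hr0.le ?_
        rw [hrr]
        nlinarith [mul_nonneg (sub_nonneg.2 ht2) (sq_nonneg Y)]
      linarith
    refine ih hY'0 (by push_cast at hYN; omega) ?_ h'
    have e : 2 * A * X' - (D + m) * Y' = 2 * Y - t * Y' := by
      rw [hX', hY', ht]
      linear_combination 2 * Y * hdet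
    have : (t ^ 2 - 4) * Y < t * r := by
      refine lt_of_pow_lt_pow_left₀ 2 (by positivity) ?_
      rw [mul_pow, mul_pow, hrr]
      have h1 : 0 ≤ t ^ 2 - 4 := by nlinarith
      have h2 : 0 < t ^ 2 * (4 * A) := by
        have : 0 < A := by linarith
        positivity
      have h3 : 0 ≤ (t ^ 2 - 4) * Y ^ 2 := mul_nonneg h1 (sq_nonneg Y)
      nlinarith
    nlinarith

/-- The form `(1 + m p) x² + (m + p + q + m p q) x y + (1 + m q) y²` does not represent `1` over the
integers. -/
theorem form_ne_one {m p q : ℤ} (hm : 1 ≤ m) (hp : 1 ≤ p) (hq : 1 ≤ q) (x y : ℤ) :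
    (1 + m * p) * x ^ 2 + (m + (p + q + m * p * q)) * (x * y) + (1 + m * q) * y ^ 2 ≠ 1 := by
  intro h
  obtain ⟨A, hA⟩ : ∃ A, A = 1 + m * p := ⟨_, rfl⟩
  obtain ⟨C, hC⟩ : ∃ C, C = 1 + m * q := ⟨_, rfl⟩
  obtain ⟨D, hD⟩ : ∃ D, D = p + q + m * p * q := ⟨_, rfl⟩
  have hdet : A * C = 1 + D * m := by rw [hA, hC, hD]; ring
  have hA1 : m + 1 ≤ A := by nlinarith
  have hC1 : m + 1 ≤ C := by nlinarith
  have hD1 : m + 2 ≤ D := by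
    have : m * 1 ≤ m * (p * q) := mul_le_mul_of_nonneg_left (by nlinarith) (by linarith)
    nlinarith
  rw [← hA, ← hC, ← hD] at h
  -- opposite signs, with the first coordinate positive
  have main : ∀ X Y : ℤ, 0 < X → 0 < Y → A * X ^ 2 - (D + m) * (X * Y) + C * Y ^ 2 ≠ 1 := by
    intro X Y hX hY hXY
    rcases lt_trichotomy ((D + m) * Y) (2 * A * X) with h1 | h1 | h1
    · exact form_ne_one_of_lt hdet hm hA1 hC1 hD1 Y.toNat hY (Int.self_le_toNat Y) h1 hXY
    · have h3 : 4 * A = -((D - m) ^ 2 - 4) * Y ^ 2 := by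
        linear_combination (-4 * A) * hXY + 4 * Y ^ 2 * hdet + ((D + m) * Y - 2 * A * X) * h1
      have h4 : 0 ≤ ((D - m) ^ 2 - 4) := by nlinarith
      have : 0 ≤ ((D - m) ^ 2 - 4) * Y ^ 2 := mul_nonneg h4 (sq_nonneg Y)
      linarith
    · have h3 : (D + m) * X < 2 * C * Y := by
        have : 0 < Y * (2 * C * Y - (D + m) * X) := by nlinarith
        have := pos_of_mul_pos_right this hY.le
        linarith
      refine form_ne_one_of_lt (A := C) (C := A) (D := D) (by linarith) hm hC1 hA1 hD1 X.toNat hX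
        (Int.self_le_toNat X) h3 ?_
      linarith
  rcases le_or_gt 0 (x * y) with h0 | h0
  · have h1 : 0 ≤ (m + D) * (x * y) := mul_nonneg (by linarith) h0
    by_cases hx : x = 0
    · subst hx
      by_cases hy : y = 0
      · subst hy; simp at h
      · have : 0 < y ^ 2 := by positivity
        nlinarith
    · have : 0 < x ^ 2 := by positivity
      nlinarith [sq_nonneg y]
  · rcases lt_or_ge 0 x with hx | hx
    · exact main x (-y) hx (by nlinarith) (by linarith)
    · have hx' : x < 0 := lt_of_le_of_ne hx (by rintro rfl; simp at h0)
      exact main (-x) y (by linarith) (by nlinarith) (by linarith)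

/-! ### Generators and relations of `R_F` -/

namespace TwoVertex

variable {𝕜 : Type u} [Field 𝕜] {n m : ℕ} (V W : Fin m → Submodule 𝕜 (Fin n → 𝕜))

namespace RF

/-- The class in `R_F` of a generator of the path algebra. -/
def of (g : Gen n m) : RF V W := RingQuot.mkAlgHom 𝕜 (FamRel V W) (gen g)

/-- The idempotent of the vertex `1`. -/
abbrev e1 : RF V W := of V W .e1

/-- The idempotent of the vertex `2`. -/
abbrev e2 : RF V W := of V W .e2

/-- The arrows `b_i`. -/
abbrev b (i : Fin m) : RF V W := of V W (.b i)

/-- The map sending a vector to the corresponding element of the span of the arrows `c_j`. -/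
def c : (Fin n → 𝕜) →ₗ[𝕜] RF V W := Fintype.linearCombination 𝕜 fun j => of V W (.c j)

lemma c_apply (x : Fin n → 𝕜) : c V W x = ∑ j, x j • of V W (.c j) := rfl

lemma mk_cElt (x : Fin n → 𝕜) : RingQuot.mkAlgHom 𝕜 (FamRel V W) (cElt x) = c V W x := by
  simp [cElt, c_apply, of]

lemma mk_gen_rel {r s : FreeAlgebra 𝕜 (Gen n m)} (h : PathRel 𝕜 n m r s) :
    RingQuot.mkAlgHom 𝕜 (FamRel V W) (RingQuot.mkAlgHom 𝕜 (PathRel 𝕜 n m) r) =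
      RingQuot.mkAlgHom 𝕜 (FamRel V W) (RingQuot.mkAlgHom 𝕜 (PathRel 𝕜 n m) s) := by
  rw [RingQuot.mkAlgHom_rel 𝕜 h]

lemma e1_mul_e1 : e1 V W * e1 V W = e1 V W := by
  simpa [of, gen] using mk_gen_rel V W .e1_e1

lemma e2_mul_e2 : e2 V W * e2 V W = e2 V W := by
  simpa [of, gen] using mk_gen_rel V W .e2_e2

lemma e1_mul_e2 : e1 V W * e2 V W = 0 := by
  simpa [of, gen] using mk_gen_rel V W .e1_e2

lemma e2_mul_e1 : e2 V W * e1 V W = 0 := by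
  simpa [of, gen] using mk_gen_rel V W .e2_e1

lemma e1_add_e2 : e1 V W + e2 V W = 1 := by
  simpa [of, gen] using mk_gen_rel V W .e1_add_e2

lemma e1_mul_b (i : Fin m) : e1 V W * b V W i = b V W i := by
  simpa [of, gen] using mk_gen_rel V W (.e1_b i)

lemma b_mul_e2 (i : Fin m) : b V W i * e2 V W = b V W i := by
  simpa [of, gen] using mk_gen_rel V W (.b_e2 i)

lemma e2_mul_c (x : Fin n → 𝕜) : e2 V W * c V W x = c V W x := by
  have h (j : Fin n) : e2 V W * of V W (.c j) = of V W (.c j) := by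
    simpa [of, gen] using mk_gen_rel V W (.e2_c j)
  simp [c_apply, Finset.mul_sum, h]

lemma c_mul_e1 (x : Fin n → 𝕜) : c V W x * e1 V W = c V W x := by
  have h (j : Fin n) : of V W (.c j) * e1 V W = of V W (.c j) := by
    simpa [of, gen] using mk_gen_rel V W (.c_e1 j)
  simp [c_apply, Finset.sum_mul, h]

lemma e2_mul_b (i : Fin m) : e2 V W * b V W i = 0 := by
  rw [← e1_mul_b, ← mul_assoc, e2_mul_e1, zero_mul]

lemma b_mul_e1 (i : Fin m) : b V W i * e1 V W = 0 := by
  rw [← b_mul_e2, mul_assoc, e2_mul_e1, mul_zero]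

lemma e1_mul_c (x : Fin n → 𝕜) : e1 V W * c V W x = 0 := by
  rw [← e2_mul_c, ← mul_assoc, e1_mul_e2, zero_mul]

lemma c_mul_e2 (x : Fin n → 𝕜) : c V W x * e2 V W = 0 := by
  rw [← c_mul_e1, mul_assoc, e1_mul_e2, mul_zero]

lemma c_mul_c (x y : Fin n → 𝕜) : c V W x * c V W y = 0 := by
  rw [← e2_mul_c V W y, ← mul_assoc, c_mul_e2, zero_mul]

lemma b_mul_b (i j : Fin m) : b V W i * b V W j = 0 := by
  rw [← e1_mul_b V W j, ← mul_assoc, b_mul_e1, zero_mul]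

lemma b_mul_c_mul_b (i : Fin m) (x : Fin n → 𝕜) (j : Fin m) :
    b V W i * c V W x * b V W j = 0 := by
  have h := RingQuot.mkAlgHom_rel 𝕜 (FamRel.bcb (V := V) (W := W) (Pi.single i 1) x (Pi.single j 1))
  simpa [bElt, mk_cElt, Pi.single_apply, of] using h

lemma c_mul_b (i : Fin m) {x : Fin n → 𝕜} (hx : x ∈ W i) : c V W x * b V W i = 0 := by
  simpa [mk_cElt, of] using RingQuot.mkAlgHom_rel 𝕜 (FamRel.wb (V := V) (W := W) i x hx)

lemma b_mul_c (i : Fin m) {x : Fin n → 𝕜} (hx : x ∈ V i) : b V W i * c V W x = 0 := by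
  simpa [mk_cElt, of] using RingQuot.mkAlgHom_rel 𝕜 (FamRel.bv (V := V) (W := W) i x hx)

/-- `R_F` is generated by the vertices and the arrows. -/
lemma eq_top_of_mem (A : Subalgebra 𝕜 (RF V W)) (h1 : e1 V W ∈ A) (h2 : e2 V W ∈ A)
    (hc : ∀ x, c V W x ∈ A) (hb : ∀ i, b V W i ∈ A) : A = ⊤ := by
  rw [eq_top_iff]
  rintro r -
  obtain ⟨r, rfl⟩ := RingQuot.mkAlgHom_surjective 𝕜 (FamRel V W) r
  obtain ⟨r, rfl⟩ := RingQuot.mkAlgHom_surjective 𝕜 (PathRel 𝕜 n m) r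
  induction r using FreeAlgebra.induction with
  | grade0 r => simp [A.algebraMap_mem]
  | grade1 g =>
    cases g with
    | e1 => exact h1
    | e2 => exact h2
    | c j => simpa [c_apply, Pi.single_apply, of, gen] using hc (Pi.single j 1)
    | b i => exact hb i
  | mul r s hr hs => simpa using A.mul_mem hr hs
  | add r s hr hs => simpa using A.add_mem hr hs

/-! ### Representations of the quiver with relations -/

section Representation

variable {U₁ U₂ : Type*} [AddCommGroup U₁] [Module 𝕜 U₁] [AddCommGroup U₂] [Module 𝕜 U₂]
  (γ : (Fin n → 𝕜) →ₗ[𝕜] U₁ →ₗ[𝕜] U₂) (β : Fin m → U₂ →ₗ[𝕜] U₁)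

/-- The operator by which a generator acts on the total space `U₁ × U₂` of a representation of
the quiver. -/
def genEnd : Gen n m → Module.End 𝕜 (U₁ × U₂)
  | .e1 => .inl 𝕜 U₁ U₂ ∘ₗ .fst 𝕜 U₁ U₂
  | .e2 => .inr 𝕜 U₁ U₂ ∘ₗ .snd 𝕜 U₁ U₂
  | .c j => .inr 𝕜 U₁ U₂ ∘ₗ γ (Pi.single j 1) ∘ₗ .fst 𝕜 U₁ U₂
  | .b i => .inl 𝕜 U₁ U₂ ∘ₗ β i ∘ₗ .snd 𝕜 U₁ U₂

/-- The action of the path algebra on a representation of the quiver. -/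
def pathRep : PathAlg 𝕜 n m →ₐ[𝕜] Module.End 𝕜 (U₁ × U₂) :=
  RingQuot.liftAlgHom 𝕜 ⟨FreeAlgebra.lift 𝕜 (genEnd γ β), fun _ _ h => by
    cases h <;> ext <;> simp [genEnd]⟩

lemma pathRep_gen (g : Gen n m) : pathRep γ β (gen g) = genEnd γ β g := by
  simp [pathRep, gen]

lemma pathRep_cElt (x : Fin n → 𝕜) (u : U₁ × U₂) : pathRep γ β (cElt x) u = (0, γ x u.1) := by
  conv_rhs => rw [pi_eq_sum_univ' x]
  simp only [cElt, map_sum, map_smul, pathRep_gen, genEnd, LinearMap.sum_apply,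
    LinearMap.smul_apply, LinearMap.comp_apply, LinearMap.fst_apply, LinearMap.inr_apply]
  ext <;> simp [Prod.fst_sum, Prod.snd_sum, Pi.single]

variable (h₁ : ∀ i x j u, β i (γ x (β j u)) = 0) (h₂ : ∀ i, ∀ x ∈ W i, ∀ u, γ x (β i u) = 0)
  (h₃ : ∀ i, ∀ x ∈ V i, ∀ u, β i (γ x u) = 0)

/-- The action of `R_F` on a representation of the quiver satisfying the relations. -/
def rep : RF V W →ₐ[𝕜] Module.End 𝕜 (U₁ × U₂) :=
  RingQuot.liftAlgHom 𝕜 ⟨pathRep γ β, fun _ _ h => by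
    cases h with
    | bcb y x y' =>
      refine LinearMap.ext fun u => ?_
      simp [bElt, pathRep_gen, genEnd, pathRep_cElt, Finset.sum_mul, Finset.mul_sum, h₁]
    | wb i x hx =>
      refine LinearMap.ext fun u => ?_
      simp [pathRep_gen, genEnd, pathRep_cElt, h₂ i x hx]
    | bv i x hx =>
      refine LinearMap.ext fun u => ?_
      simp [pathRep_gen, genEnd, pathRep_cElt, h₃ i x hx]⟩

lemma rep_e1 (u : U₁ × U₂) : rep V W γ β h₁ h₂ h₃ (e1 V W) u = (u.1, 0) := by
  simp [rep, of, pathRep_gen, genEnd]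

lemma rep_e2 (u : U₁ × U₂) : rep V W γ β h₁ h₂ h₃ (e2 V W) u = (0, u.2) := by
  simp [rep, of, pathRep_gen, genEnd]

lemma rep_b (i : Fin m) (u : U₁ × U₂) :
    rep V W γ β h₁ h₂ h₃ (b V W i) u = (β i u.2, 0) := by
  simp [rep, of, pathRep_gen, genEnd]

lemma rep_c (x : Fin n → 𝕜) (u : U₁ × U₂) :
    rep V W γ β h₁ h₂ h₃ (c V W x) u = (0, γ x u.1) := by
  rw [← mk_cElt]
  simp [rep, pathRep_cElt]

end Representation

end RF

end TwoVertex

/-! ### Dimensions of the Peirce components -/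

/-- The Peirce component `f R e`, for idempotents `f` and `e`. -/
def peirceComponent (𝕜 : Type*) {R : Type*} [CommSemiring 𝕜] [Semiring R] [Algebra 𝕜 R]
    (f e : R) : Submodule 𝕜 R where
  carrier := {r | f * r = r ∧ r * e = r}
  add_mem' ha hb := by simp_all [mul_add, add_mul]
  zero_mem' := by simp
  smul_mem' t r h := by simp_all

namespace TwoVertex

namespace RF

variable {𝕜 : Type u} [Field 𝕜] {n m : ℕ} (V W : Fin m → Submodule 𝕜 (Fin n → 𝕜))

section

variable {U₁ U₂ : Type*} [AddCommGroup U₁] [Module 𝕜 U₁] [AddCommGroup U₂] [Module 𝕜 U₂]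
  (γ : (Fin n → 𝕜) →ₗ[𝕜] U₁ →ₗ[𝕜] U₂) (β : Fin m → U₂ →ₗ[𝕜] U₁)
  (h₁ : ∀ i x j u, β i (γ x (β j u)) = 0) (h₂ : ∀ i, ∀ x ∈ W i, ∀ u, γ x (β i u) = 0)
  (h₃ : ∀ i, ∀ x ∈ V i, ∀ u, β i (γ x u) = 0)

/-- A representation generated by a vector `u₀`, with a section `σ` of `r ↦ r u₀` that is
compatible with the arrows and sends `u₀` to `e`, is the left module `R_F e`. -/
lemma finrank_peirceComponent_of_section (e : RF V W) (u₀ : U₁ × U₂) (σ : U₁ × U₂ →ₗ[𝕜] RF V W)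
    (hσ : σ u₀ = e) (hev : ∀ u, rep V W γ β h₁ h₂ h₃ (σ u) u₀ = u)
    (hσ1 : ∀ u, e1 V W * σ u = σ (u.1, 0)) (hσ2 : ∀ u, e2 V W * σ u = σ (0, u.2))
    (hσb : ∀ i u, b V W i * σ u = σ (β i u.2, 0))
    (hσc : ∀ x u, c V W x * σ u = σ (0, γ x u.1)) :
    Module.finrank 𝕜 (peirceComponent 𝕜 (e1 V W) e) = Module.finrank 𝕜 U₁ ∧
      Module.finrank 𝕜 (peirceComponent 𝕜 (e2 V W) e) = Module.finrank 𝕜 U₂ ∧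
      ∀ r, ∃ u, r * e = σ u := by
  -- `σ` is a homomorphism of left modules
  let A : Subalgebra 𝕜 (RF V W) :=
    { carrier := {r | ∀ u, r * σ u = σ (rep V W γ β h₁ h₂ h₃ r u)}
      mul_mem' := fun {a b} ha hb u => by simp [mul_assoc, hb u, ha _]
      add_mem' := fun {a b} ha hb u => by simp [add_mul, hb u, ha u]
      algebraMap_mem' := fun t u => by simp [Algebra.algebraMap_eq_smul_one] }
  have hA : A = ⊤ := eq_top_of_mem V W A (fun u => by rw [hσ1, rep_e1])
    (fun u => by rw [hσ2, rep_e2]) (fun x u => by rw [hσc, rep_c]) (fun i u => by rw [hσb, rep_b])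
  have hlin (r : RF V W) (u : U₁ × U₂) : r * σ u = σ (rep V W γ β h₁ h₂ h₃ r u) :=
    (hA ▸ Algebra.mem_top : r ∈ A) u
  have hσe (u) : σ u * e = σ u := by rw [← hσ, hlin, hev]
  have hinj : Function.Injective σ := fun u u' h => by rw [← hev u, h, hev]
  have hre (r : RF V W) (h : r * e = r) : r = σ (rep V W γ β h₁ h₂ h₃ r u₀) := by
    rw [← hlin, hσ, h]
  refine ⟨?_, ?_, fun r => ⟨_, by rw [← hσ, hlin]⟩⟩
  · rw [← LinearMap.finrank_range_of_inj (f := σ ∘ₗ .inl 𝕜 U₁ U₂)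
      (hinj.comp LinearMap.inl_injective)]
    suffices h : peirceComponent 𝕜 (e1 V W) e = LinearMap.range (σ ∘ₗ .inl 𝕜 U₁ U₂) by rw [h]
    ext r
    constructor
    · rintro ⟨hr1, hr⟩
      refine ⟨(rep V W γ β h₁ h₂ h₃ r u₀).1, ?_⟩
      rw [LinearMap.comp_apply, LinearMap.inl_apply, ← hσ1, ← hre r hr, hr1]
    · rintro ⟨u, rfl⟩
      exact ⟨by simp [hσ1], hσe _⟩
  · rw [← LinearMap.finrank_range_of_inj (f := σ ∘ₗ .inr 𝕜 U₁ U₂)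
      (hinj.comp LinearMap.inr_injective)]
    suffices h : peirceComponent 𝕜 (e2 V W) e = LinearMap.range (σ ∘ₗ .inr 𝕜 U₁ U₂) by rw [h]
    ext r
    constructor
    · rintro ⟨hr1, hr⟩
      refine ⟨(rep V W γ β h₁ h₂ h₃ r u₀).2, ?_⟩
      rw [LinearMap.comp_apply, LinearMap.inr_apply, ← hσ2, ← hre r hr, hr1]
    · rintro ⟨u, rfl⟩
      exact ⟨by simp [hσ2], hσe _⟩

end

end RF

end TwoVertex

namespace TwoVertex

namespace RF

variable {𝕜 : Type u} [Field 𝕜] {n m : ℕ} (V W : Fin m → Submodule 𝕜 (Fin n → 𝕜))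

open scoped TensorProduct

/-- The ring structure of `R_F`. As a local instance, it spares a nested search for the ring
structure of the path algebra. -/
abbrev ringRF : Ring (RF V W) := inferInstance

attribute [local instance] ringRF

/-! ### The projective modules `R_F e_1` and `R_F e_2` -/

/-- The action of the arrows `c_j` on `R_F e_1`, whose components at the vertices are
`𝕜 × ∏ i, C / V_i` (the classes of `e_1` and `b_i v`) and `C × ∏ i, C / W_i ⊗ C / V_i` (the classes
of `c` and `c b_i c'`). -/
def gammaOne : (Fin n → 𝕜) →ₗ[𝕜] (𝕜 × ∀ i, (Fin n → 𝕜) ⧸ V i) →ₗ[𝕜]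
    ((Fin n → 𝕜) × ∀ i, ((Fin n → 𝕜) ⧸ W i) ⊗[𝕜] ((Fin n → 𝕜) ⧸ V i)) :=
  LinearMap.mk₂ 𝕜 (fun x u => (u.1 • x, fun i => (W i).mkQ x ⊗ₜ u.2 i))
    (fun x y u => by ext <;> simp [TensorProduct.add_tmul, mul_add])
    (fun t x u => by ext <;> simp [TensorProduct.smul_tmul', mul_left_comm])
    (fun x u u' => by ext <;> simp [TensorProduct.tmul_add, add_mul])
    (fun t x u => by ext <;> simp [mul_assoc])

/-- The action of the arrows `b_i` on `R_F e_1`. -/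
def betaOne (i : Fin m) : ((Fin n → 𝕜) × ∀ i, ((Fin n → 𝕜) ⧸ W i) ⊗[𝕜] ((Fin n → 𝕜) ⧸ V i)) →ₗ[𝕜]
    (𝕜 × ∀ i, (Fin n → 𝕜) ⧸ V i) :=
  .inr 𝕜 _ _ ∘ₗ .single 𝕜 (fun i => (Fin n → 𝕜) ⧸ V i) i ∘ₗ (V i).mkQ ∘ₗ .fst 𝕜 _ _

/-- The map `C / V_i → R_F` sending the class of `v` to `b_i v`. -/
def bc (i : Fin m) : ((Fin n → 𝕜) ⧸ V i) →ₗ[𝕜] RF V W :=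
  (V i).liftQ (LinearMap.mulLeft 𝕜 (b V W i) ∘ₗ c V W) fun x hx => by simp [b_mul_c V W i hx]

@[simp]
lemma bc_mk (i : Fin m) (x : Fin n → 𝕜) :
    bc V W i (Submodule.Quotient.mk x) = b V W i * c V W x := rfl

lemma b_mul_c_mul_bc (i j : Fin m) (x : Fin n → 𝕜) (z) :
    b V W j * (c V W x * bc V W i z) = 0 := by
  obtain ⟨z, rfl⟩ := Submodule.Quotient.mk_surjective _ z
  rw [bc_mk, ← mul_assoc, ← mul_assoc, b_mul_c_mul_b, zero_mul]

lemma b_mul_bc (i j : Fin m) (z) : b V W j * bc V W i z = 0 := by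
  obtain ⟨z, rfl⟩ := Submodule.Quotient.mk_surjective _ z
  rw [bc_mk, ← mul_assoc, b_mul_b, zero_mul]

lemma e1_mul_bc (i : Fin m) (z) : e1 V W * bc V W i z = bc V W i z := by
  obtain ⟨z, rfl⟩ := Submodule.Quotient.mk_surjective _ z
  rw [bc_mk, ← mul_assoc, e1_mul_b]

lemma e2_mul_bc (i : Fin m) (z) : e2 V W * bc V W i z = 0 := by
  obtain ⟨z, rfl⟩ := Submodule.Quotient.mk_surjective _ z
  rw [bc_mk, ← mul_assoc, e2_mul_b, zero_mul]

/-- The map `C / W_i ⊗ C / V_i → R_F` sending the class of `w ⊗ v` to `w b_i v`. -/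
def cbc (i : Fin m) : (((Fin n → 𝕜) ⧸ W i) ⊗[𝕜] ((Fin n → 𝕜) ⧸ V i)) →ₗ[𝕜] RF V W :=
  TensorProduct.lift <| (W i).liftQ (((LinearMap.mul 𝕜 (RF V W)).comp (c V W)).compl₂ (bc V W i))
    fun x hx => by ext; simp [← mul_assoc, c_mul_b V W i hx]

@[simp]
lemma cbc_mk_tmul (i : Fin m) (x : Fin n → 𝕜) (z) :
    cbc V W i (Submodule.Quotient.mk x ⊗ₜ z) = c V W x * bc V W i z := rfl

/-- The isomorphism of the representation given by `gammaOne` and `betaOne` with `R_F e_1`. -/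
def sectionOne : (𝕜 × ∀ i, (Fin n → 𝕜) ⧸ V i) ×
    ((Fin n → 𝕜) × ∀ i, ((Fin n → 𝕜) ⧸ W i) ⊗[𝕜] ((Fin n → 𝕜) ⧸ V i)) →ₗ[𝕜] RF V W :=
  ((LinearMap.toSpanSingleton 𝕜 _ (e1 V W)).coprod (LinearMap.lsum 𝕜 _ 𝕜 (bc V W))).coprod
    ((c V W).coprod (LinearMap.lsum 𝕜 _ 𝕜 (cbc V W)))

lemma sectionOne_apply (u) : sectionOne V W u =
    u.1.1 • e1 V W + ∑ i, bc V W i (u.1.2 i) + (c V W u.2.1 + ∑ i, cbc V W i (u.2.2 i)) := by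
  simp [sectionOne]

/-- Induction for the image of `C / W_i ⊗ C / V_i` in `R_F`. -/
lemma induction_cbc {i : Fin m} {p : RF V W → Prop} (h0 : p 0) (hadd : ∀ r s, p r → p s → p (r + s))
    (h : ∀ x z, p (c V W x * bc V W i z)) (t) : p (cbc V W i t) := by
  induction t with
  | zero => simpa using h0
  | tmul x z =>
    obtain ⟨x, rfl⟩ := Submodule.Quotient.mk_surjective _ x
    exact h x z
  | add s t hs ht => simpa using hadd _ _ hs ht

lemma e1_mul_cbc (i : Fin m) (t) : e1 V W * cbc V W i t = 0 := by
  refine induction_cbc V W (p := fun r => e1 V W * r = 0) (by simp)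
    (fun r s hr hs => by simp [mul_add, hr, hs]) (fun x z => ?_) t
  rw [← mul_assoc, e1_mul_c, zero_mul]

lemma e2_mul_cbc (i : Fin m) (t) : e2 V W * cbc V W i t = cbc V W i t := by
  refine induction_cbc V W (p := fun r => e2 V W * r = r) (by simp)
    (fun r s hr hs => by simp [mul_add, hr, hs]) (fun x z => ?_) t
  rw [← mul_assoc, e2_mul_c]

lemma b_mul_cbc (i j : Fin m) (t) : b V W j * cbc V W i t = 0 := by
  refine induction_cbc V W (p := fun r => b V W j * r = 0) (by simp)
    (fun r s hr hs => by simp [mul_add, hr, hs]) (fun x z => ?_) t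
  rw [b_mul_c_mul_bc]

lemma c_mul_cbc (i : Fin m) (x) (t) : c V W x * cbc V W i t = 0 := by
  refine induction_cbc V W (p := fun r => c V W x * r = 0) (by simp)
    (fun r s hr hs => by simp [mul_add, hr, hs]) (fun x z => ?_) t
  rw [← mul_assoc, c_mul_c, zero_mul]

/-- The Peirce components of `R_F e_1`; moreover every element of `R_F e_1` is in normal form. -/
lemma finrank_peirceComponent_e1 :
    Module.finrank 𝕜 (peirceComponent 𝕜 (e1 V W) (e1 V W)) =
      Module.finrank 𝕜 (𝕜 × ∀ i, (Fin n → 𝕜) ⧸ V i) ∧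
    Module.finrank 𝕜 (peirceComponent 𝕜 (e2 V W) (e1 V W)) =
      Module.finrank 𝕜 ((Fin n → 𝕜) × ∀ i, ((Fin n → 𝕜) ⧸ W i) ⊗[𝕜] ((Fin n → 𝕜) ⧸ V i)) ∧
    ∀ r, ∃ u, r * e1 V W = sectionOne V W u := by
  have h₁ : ∀ i x j u, betaOne V W i (gammaOne V W x (betaOne V W j u)) = 0 := by
    intro i x j u
    simp [betaOne, gammaOne]
  have h₂ : ∀ i, ∀ x ∈ W i, ∀ u, gammaOne V W x (betaOne V W i u) = 0 := by
    intro i x hx u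
    refine Prod.ext (by simp [betaOne, gammaOne]) (funext fun j => ?_)
    by_cases hj : j = i
    · subst hj
      simp [betaOne, gammaOne, (Submodule.Quotient.mk_eq_zero _).2 hx]
    · simp [betaOne, gammaOne, hj]
  have h₃ : ∀ i, ∀ x ∈ V i, ∀ u, betaOne V W i (gammaOne V W x u) = 0 := by
    intro i x hx u
    simp [betaOne, gammaOne, (Submodule.Quotient.mk_eq_zero _).2 hx]
  refine finrank_peirceComponent_of_section V W (U₁ := 𝕜 × ∀ i, (Fin n → 𝕜) ⧸ V i)
    (U₂ := (Fin n → 𝕜) × ∀ i, ((Fin n → 𝕜) ⧸ W i) ⊗[𝕜] ((Fin n → 𝕜) ⧸ V i))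
    (gammaOne V W) (betaOne V W) h₁ h₂ h₃ (e1 V W) ((1, 0), 0) (sectionOne V W)
    (by simp [sectionOne_apply]) (fun u => ?_) (fun u => ?_) (fun u => ?_) (fun i u => ?_)
    (fun x u => ?_)
  · have hbc (i z) : rep V W (gammaOne V W) (betaOne V W) h₁ h₂ h₃ (bc V W i z) ((1, 0), 0) =
        (((0, Pi.single i z), 0) : (𝕜 × ∀ i, (Fin n → 𝕜) ⧸ V i) ×
          ((Fin n → 𝕜) × ∀ i, ((Fin n → 𝕜) ⧸ W i) ⊗[𝕜] ((Fin n → 𝕜) ⧸ V i))) := by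
      obtain ⟨z, rfl⟩ := Submodule.Quotient.mk_surjective _ z
      simp [rep_c, rep_b, betaOne, gammaOne]
    have hcbc (i t) : rep V W (gammaOne V W) (betaOne V W) h₁ h₂ h₃ (cbc V W i t) ((1, 0), 0) =
        ((0, (0, Pi.single i t)) : (𝕜 × ∀ i, (Fin n → 𝕜) ⧸ V i) ×
          ((Fin n → 𝕜) × ∀ i, ((Fin n → 𝕜) ⧸ W i) ⊗[𝕜] ((Fin n → 𝕜) ⧸ V i))) := by
      induction t with
      | zero =>
        simp only [map_zero, LinearMap.zero_apply, Pi.single_zero]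
        rfl
      | tmul x z =>
        obtain ⟨x, rfl⟩ := Submodule.Quotient.mk_surjective _ x
        simp only [cbc_mk_tmul, map_mul, Module.End.mul_apply, hbc, rep_c]
        refine Prod.ext rfl (Prod.ext (by simp [gammaOne]) (funext fun j => ?_))
        by_cases hj : j = i
        · subst hj
          simp [gammaOne]
        · simp [gammaOne, hj]
      | add s t hs ht => simp [hs, ht, Pi.single_add]
    rw [sectionOne_apply]
    simp only [map_add, map_smul, map_sum, LinearMap.add_apply, LinearMap.smul_apply,
      LinearMap.sum_apply, hbc, hcbc, rep_e1, rep_c]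
    ext i <;> simp [gammaOne, Prod.fst_sum, Prod.snd_sum]
  · simp [sectionOne_apply, mul_add, Finset.mul_sum, e1_mul_e1, e1_mul_bc, e1_mul_c, e1_mul_cbc]
  · simp [sectionOne_apply, mul_add, Finset.mul_sum, e2_mul_e1, e2_mul_bc, e2_mul_c, e2_mul_cbc]
  · simp [sectionOne_apply, mul_add, Finset.mul_sum, b_mul_bc, b_mul_cbc, b_mul_e1, betaOne]
    rw [Finset.sum_eq_single i (fun j _ hj => by simp [hj]) (by simp)]
    simp
  · simp [sectionOne_apply, mul_add, Finset.mul_sum, c_mul_e1, c_mul_c, c_mul_cbc, gammaOne]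

/-- The action of the arrows `c_j` on `R_F e_2`, whose components at the vertices are
`B` and `𝕜 × ∏ i, C / W_i` (the classes of `e_2` and `w b_i`). -/
def gammaTwo : (Fin n → 𝕜) →ₗ[𝕜] (Fin m → 𝕜) →ₗ[𝕜] (𝕜 × ∀ i, (Fin n → 𝕜) ⧸ W i) :=
  LinearMap.mk₂ 𝕜 (fun x u => (0, fun i => u i • (W i).mkQ x))
    (fun x y u => by ext <;> simp)
    (fun t x u => by ext <;> simp [smul_comm (u _) t])
    (fun x u u' => by ext <;> simp [add_smul])
    (fun t x u => by ext <;> simp [mul_smul])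

/-- The action of the arrows `b_i` on `R_F e_2`. -/
def betaTwo (i : Fin m) : (𝕜 × ∀ i, (Fin n → 𝕜) ⧸ W i) →ₗ[𝕜] (Fin m → 𝕜) :=
  .single 𝕜 (fun _ => 𝕜) i ∘ₗ .fst 𝕜 _ _

/-- The map `C / W_i → R_F` sending the class of `w` to `w b_i`. -/
def cb (i : Fin m) : ((Fin n → 𝕜) ⧸ W i) →ₗ[𝕜] RF V W :=
  (W i).liftQ (LinearMap.mulRight 𝕜 (b V W i) ∘ₗ c V W) fun x hx => by simp [c_mul_b V W i hx]

@[simp]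
lemma cb_mk (i : Fin m) (x : Fin n → 𝕜) :
    cb V W i (Submodule.Quotient.mk x) = c V W x * b V W i := rfl

lemma e1_mul_cb (i : Fin m) (z) : e1 V W * cb V W i z = 0 := by
  obtain ⟨z, rfl⟩ := Submodule.Quotient.mk_surjective _ z
  rw [cb_mk, ← mul_assoc, e1_mul_c, zero_mul]

lemma e2_mul_cb (i : Fin m) (z) : e2 V W * cb V W i z = cb V W i z := by
  obtain ⟨z, rfl⟩ := Submodule.Quotient.mk_surjective _ z
  rw [cb_mk, ← mul_assoc, e2_mul_c]

lemma b_mul_cb (i j : Fin m) (z) : b V W j * cb V W i z = 0 := by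
  obtain ⟨z, rfl⟩ := Submodule.Quotient.mk_surjective _ z
  rw [cb_mk, ← mul_assoc, b_mul_c_mul_b]

lemma c_mul_cb (i : Fin m) (x) (z) : c V W x * cb V W i z = 0 := by
  obtain ⟨z, rfl⟩ := Submodule.Quotient.mk_surjective _ z
  rw [cb_mk, ← mul_assoc, c_mul_c, zero_mul]

/-- The isomorphism of the representation given by `gammaTwo` and `betaTwo` with `R_F e_2`. -/
def sectionTwo : (Fin m → 𝕜) × (𝕜 × ∀ i, (Fin n → 𝕜) ⧸ W i) →ₗ[𝕜] RF V W :=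
  (Fintype.linearCombination 𝕜 (b V W)).coprod
    ((LinearMap.toSpanSingleton 𝕜 _ (e2 V W)).coprod (LinearMap.lsum 𝕜 _ 𝕜 (cb V W)))

lemma sectionTwo_apply (u) : sectionTwo V W u =
    ∑ i, u.1 i • b V W i + (u.2.1 • e2 V W + ∑ i, cb V W i (u.2.2 i)) := by
  simp [sectionTwo, Fintype.linearCombination_apply]

/-- The Peirce components of `R_F e_2`; moreover every element of `R_F e_2` is in normal form. -/
lemma finrank_peirceComponent_e2 :
    Module.finrank 𝕜 (peirceComponent 𝕜 (e1 V W) (e2 V W)) = Module.finrank 𝕜 (Fin m → 𝕜) ∧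
    Module.finrank 𝕜 (peirceComponent 𝕜 (e2 V W) (e2 V W)) =
      Module.finrank 𝕜 (𝕜 × ∀ i, (Fin n → 𝕜) ⧸ W i) ∧
    ∀ r, ∃ u, r * e2 V W = sectionTwo V W u := by
  have h₁ : ∀ i x j u, betaTwo W i (gammaTwo W x (betaTwo W j u)) = 0 := by
    intro i x j u
    simp [betaTwo, gammaTwo]
  have h₂ : ∀ i, ∀ x ∈ W i, ∀ u, gammaTwo W x (betaTwo W i u) = 0 := by
    intro i x hx u
    refine Prod.ext (by simp [betaTwo, gammaTwo]) (funext fun j => ?_)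
    by_cases hj : j = i
    · subst hj
      simp [betaTwo, gammaTwo, (Submodule.Quotient.mk_eq_zero _).2 hx]
    · simp [betaTwo, gammaTwo, hj]
  have h₃ : ∀ i, ∀ x ∈ V i, ∀ u, betaTwo W i (gammaTwo W x u) = 0 := by
    intro i x hx u
    simp [betaTwo, gammaTwo]
  refine finrank_peirceComponent_of_section V W (gammaTwo W) (betaTwo W) h₁ h₂ h₃ (e2 V W)
    (0, ((1 : 𝕜), 0)) (sectionTwo V W) (by simp [sectionTwo_apply]) (fun u => ?_) (fun u => ?_)
    (fun u => ?_) (fun i u => ?_) (fun x u => ?_)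
  · have hcb (i z) : rep V W (gammaTwo W) (betaTwo W) h₁ h₂ h₃ (cb V W i z) (0, (1, 0)) =
        ((0, (0, Pi.single i z)) : (Fin m → 𝕜) × (𝕜 × ∀ i, (Fin n → 𝕜) ⧸ W i)) := by
      obtain ⟨z, rfl⟩ := Submodule.Quotient.mk_surjective _ z
      simp only [cb_mk, map_mul, Module.End.mul_apply, rep_b, rep_c]
      refine Prod.ext rfl (Prod.ext (by simp [gammaTwo]) (funext fun j => ?_))
      by_cases hj : j = i
      · subst hj
        simp [gammaTwo, betaTwo]
      · simp [gammaTwo, betaTwo, hj]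
    rw [sectionTwo_apply]
    simp only [map_add, map_smul, map_sum, LinearMap.add_apply, LinearMap.smul_apply,
      LinearMap.sum_apply, hcb, rep_e2, rep_b]
    ext i <;> simp [betaTwo, Prod.fst_sum, Prod.snd_sum, Pi.single_apply]
  · simp [sectionTwo_apply, mul_add, Finset.mul_sum, e1_mul_e2, e1_mul_b, e1_mul_cb]
  · simp [sectionTwo_apply, mul_add, Finset.mul_sum, e2_mul_e2, e2_mul_b, e2_mul_cb]
  · simp [sectionTwo_apply, mul_add, Finset.mul_sum, b_mul_e2, b_mul_b, b_mul_cb, betaTwo]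
  · simp [sectionTwo_apply, mul_add, Finset.mul_sum, c_mul_e2, c_mul_cb, gammaTwo]

/-! ### The radical -/

/-- The span of the arrows `b_i`. -/
def spanB : Submodule 𝕜 (RF V W) := Submodule.span 𝕜 (Set.range (b V W))

/-- The span of the arrows `c_j`. -/
def spanC : Submodule 𝕜 (RF V W) := LinearMap.range (c V W)

/-- The span of the paths of positive length. -/
def radical : Submodule 𝕜 (RF V W) :=
  spanB V W + spanC V W + spanB V W * spanC V W + spanC V W * spanB V W +
    spanC V W * (spanB V W * spanC V W)

lemma spanB_mul_spanB : spanB V W * spanB V W = 0 := by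
  rw [Submodule.zero_eq_bot, ← le_bot_iff, spanB, Submodule.span_mul_span, Submodule.span_le]
  rintro _ ⟨_, ⟨i, rfl⟩, _, ⟨j, rfl⟩, rfl⟩
  simp [b_mul_b]

lemma spanC_mul_spanC : spanC V W * spanC V W = 0 := by
  rw [Submodule.zero_eq_bot, ← le_bot_iff, Submodule.mul_le]
  rintro _ ⟨x, rfl⟩ _ ⟨y, rfl⟩
  simp [c_mul_c]

lemma spanB_mul_spanC_mul_spanB : spanB V W * (spanC V W * spanB V W) = 0 := by
  rw [Submodule.zero_eq_bot, ← le_bot_iff, ← mul_assoc, spanC,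
    ← Submodule.span_eq (LinearMap.range (c V W)), spanB, Submodule.span_mul_span,
    Submodule.span_mul_span, Submodule.span_le]
  rintro _ ⟨_, ⟨_, ⟨i, rfl⟩, _, ⟨x, rfl⟩, rfl⟩, _, ⟨j, rfl⟩, rfl⟩
  simp [b_mul_c_mul_b]

/-- A path of length `4` contains one of the zero paths `b b'`, `c c'`, `b c b'`. -/
lemma radical_pow_four : radical V W ^ 4 = 0 := by
  have hB : spanB V W * spanB V W = 0 := spanB_mul_spanB V W
  have hC : spanC V W * spanC V W = 0 := spanC_mul_spanC V W
  have hBCB : spanB V W * (spanC V W * spanB V W) = 0 := spanB_mul_spanC_mul_spanB V W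
  have hB' (X) : spanB V W * (spanB V W * X) = 0 := by rw [← mul_assoc, hB, zero_mul]
  have hC' (X) : spanC V W * (spanC V W * X) = 0 := by rw [← mul_assoc, hC, zero_mul]
  have hBCB' (X) : spanB V W * (spanC V W * (spanB V W * X)) = 0 := by
    rw [← mul_assoc (spanC V W), ← mul_assoc, hBCB, zero_mul]
  simp only [pow_succ, pow_zero, one_mul, radical, mul_add, add_mul, mul_assoc, hB, hC, hBCB, hB',
    hC', hBCB', add_zero, zero_add, mul_zero]

lemma b_mem_radical (i : Fin m) : b V W i ∈ radical V W :=
  (((le_sup_left.trans le_sup_left).trans le_sup_left).trans le_sup_left :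
    spanB V W ≤ radical V W) (Submodule.subset_span ⟨i, rfl⟩)

lemma c_mem_radical (x : Fin n → 𝕜) : c V W x ∈ radical V W :=
  (((le_sup_right.trans le_sup_left).trans le_sup_left).trans le_sup_left :
    spanC V W ≤ radical V W) ⟨x, rfl⟩

lemma bc_mem_spanB_mul_spanC (i : Fin m) (z) : bc V W i z ∈ spanB V W * spanC V W := by
  obtain ⟨z, rfl⟩ := Submodule.Quotient.mk_surjective _ z
  exact Submodule.mul_mem_mul (Submodule.subset_span ⟨i, rfl⟩) ⟨z, rfl⟩

lemma bc_mem_radical (i : Fin m) (z) : bc V W i z ∈ radical V W :=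
  ((le_sup_right.trans le_sup_left).trans le_sup_left :
    spanB V W * spanC V W ≤ radical V W) (bc_mem_spanB_mul_spanC V W i z)

lemma cb_mem_radical (i : Fin m) (z) : cb V W i z ∈ radical V W := by
  obtain ⟨z, rfl⟩ := Submodule.Quotient.mk_surjective _ z
  exact (le_sup_right.trans le_sup_left : spanC V W * spanB V W ≤ radical V W)
    (Submodule.mul_mem_mul ⟨z, rfl⟩ (Submodule.subset_span ⟨i, rfl⟩))

lemma cbc_mem_radical (i : Fin m) (t) : cbc V W i t ∈ radical V W :=
  induction_cbc V W (zero_mem _) (fun _ _ hr hs => add_mem hr hs)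
    (fun x z => (le_sup_right : spanC V W * (spanB V W * spanC V W) ≤ radical V W)
      (Submodule.mul_mem_mul ⟨x, rfl⟩ (bc_mem_spanB_mul_spanC V W i z))) t

lemma e1_mul_e1_mem (r : RF V W) : ∃ a : 𝕜, e1 V W * r * e1 V W - a • e1 V W ∈ radical V W := by
  obtain ⟨u, hu⟩ := (finrank_peirceComponent_e1 V W).2.2 r
  refine ⟨u.1.1, ?_⟩
  rw [mul_assoc, hu, sectionOne_apply]
  simp only [mul_add, mul_smul_comm, e1_mul_e1, Finset.mul_sum, e1_mul_bc, e1_mul_c, e1_mul_cbc,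
    Finset.sum_const_zero, add_zero, add_sub_cancel_left]
  exact sum_mem fun i _ => bc_mem_radical V W i _

lemma e2_mul_e1_mem (r : RF V W) : e2 V W * r * e1 V W ∈ radical V W := by
  obtain ⟨u, hu⟩ := (finrank_peirceComponent_e1 V W).2.2 r
  rw [mul_assoc, hu, sectionOne_apply]
  simp only [mul_add, mul_smul_comm, e2_mul_e1, Finset.mul_sum, e2_mul_bc, e2_mul_c, e2_mul_cbc,
    Finset.sum_const_zero, add_zero, smul_zero, zero_add]
  exact add_mem (c_mem_radical V W _) (sum_mem fun i _ => cbc_mem_radical V W i _)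

lemma e1_mul_e2_mem (r : RF V W) : e1 V W * r * e2 V W ∈ radical V W := by
  obtain ⟨u, hu⟩ := (finrank_peirceComponent_e2 V W).2.2 r
  rw [mul_assoc, hu, sectionTwo_apply]
  simp only [mul_add, mul_smul_comm, e1_mul_e2, Finset.mul_sum, e1_mul_b, e1_mul_cb,
    Finset.sum_const_zero, add_zero, smul_zero]
  exact sum_mem fun i _ => Submodule.smul_mem _ _ (b_mem_radical V W i)

lemma e2_mul_e2_mem (r : RF V W) : ∃ a : 𝕜, e2 V W * r * e2 V W - a • e2 V W ∈ radical V W := by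
  obtain ⟨u, hu⟩ := (finrank_peirceComponent_e2 V W).2.2 r
  refine ⟨u.2.1, ?_⟩
  rw [mul_assoc, hu, sectionTwo_apply]
  simp only [mul_add, mul_smul_comm, e2_mul_e2, Finset.mul_sum, e2_mul_b, e2_mul_cb,
    Finset.sum_const_zero, smul_zero, zero_add, add_sub_cancel_left]
  exact sum_mem fun i _ => cb_mem_radical V W i _

lemma finite_RF : Module.Finite 𝕜 (RF V W) := by
  refine Module.Finite.of_surjective ((sectionOne V W).coprod (sectionTwo V W)) fun r => ?_
  obtain ⟨u, hu⟩ := (finrank_peirceComponent_e1 V W).2.2 r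
  obtain ⟨v, hv⟩ := (finrank_peirceComponent_e2 V W).2.2 r
  refine ⟨(u, v), ?_⟩
  rw [LinearMap.coprod_apply, ← hu, ← hv, ← mul_add, e1_add_e2, mul_one]

end RF

end TwoVertex

/-! ### Projective modules over a split basic algebra -/

/-- A complete system of idempotents `e` in an algebra `S` over a field, such that modulo a
nilpotent subspace `J` the Peirce components `e_i S e_j` are spanned by `e_i` for `i = j` and vanish
for `i ≠ j`. The nonzero left modules `S e_i` are then the indecomposable projective modules of
`S`. -/
structure IsSplitBasic (𝕜 : Type*) {S ι : Type*} [Field 𝕜] [Ring S] [Algebra 𝕜 S] [Fintype ι]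
    (e : ι → S) (J : Submodule 𝕜 S) : Prop where
  mul_self (i : ι) : e i * e i = e i
  sum_eq_one : ∑ i, e i = 1
  isNilpotent : IsNilpotent J
  diag (i : ι) (s : S) : ∃ a : 𝕜, e i * s * e i - a • e i ∈ J
  offDiag (i j : ι) (h : i ≠ j) (s : S) : e i * s * e j ∈ J

/-- The component `e M` of a module `M` at an idempotent `e`. -/
def fixedSubmodule (𝕜 : Type*) {S : Type*} (M : Type*) [CommSemiring 𝕜] [Semiring S] [Algebra 𝕜 S]
    [AddCommMonoid M] [Module S M] [Module 𝕜 M] [IsScalarTower 𝕜 S M] (e : S) : Submodule 𝕜 M where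
  carrier := {x | e • x = x}
  add_mem' ha hb := by simp_all
  zero_mem' := by simp
  smul_mem' t x h := by
    have h : e • x = x := h
    change e • t • x = t • x
    rw [smul_comm, h]

/-- The left ideal `S e` generated by an idempotent `e`. -/
def leftIdeal {S : Type*} [Semiring S] (e : S) : Submodule S S where
  carrier := {s | s * e = s}
  add_mem' ha hb := by simp_all [add_mul]
  zero_mem' := by simp
  smul_mem' t s h := by simp_all [mul_assoc]

section

variable {𝕜 S ι : Type*} [Field 𝕜] [Ring S] [Algebra 𝕜 S] [Fintype ι]

lemma IsSplitBasic.exists_not_mem {e : ι → S} {J : Submodule 𝕜 S} (h : IsSplitBasic 𝕜 e J) {s : S}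
    (hs : s ∉ J) : ∃ i, e i * s * e i ∉ J := by
  by_contra! H
  apply hs
  have : s = ∑ i, ∑ j, e i * s * e j := by
    simp_rw [← Finset.mul_sum, h.sum_eq_one, mul_one, ← Finset.sum_mul, h.sum_eq_one, one_mul]
  rw [this]
  refine sum_mem fun i _ => sum_mem fun j _ => ?_
  by_cases hij : i = j
  · exact hij ▸ H i
  · exact h.offDiag i j hij s

/-- An element of `e_i S e_i` outside of `J` generates the left ideal `S e_i`. -/
lemma IsSplitBasic.exists_mul_eq {e : ι → S} {J : Submodule 𝕜 S} (h : IsSplitBasic 𝕜 e J) {s : S}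
    {i : ι} (hs : e i * s * e i ∉ J) : ∃ t, t * (e i * s * e i) = e i := by
  obtain ⟨a, ha⟩ := h.diag i s
  obtain ⟨N, hN⟩ := h.isNilpotent
  set j := e i * s * e i - a • e i with hj
  have ha0 : a ≠ 0 := by
    rintro rfl
    simp_all
  have hnil : IsNilpotent j := ⟨N, by
    have : j ^ N ∈ J ^ N := Submodule.pow_mem_pow J ha N
    rwa [hN] at this⟩
  have hje : j * e i = j := by simp [hj, sub_mul, mul_assoc, h.mul_self]
  have hu : IsUnit (algebraMap 𝕜 S a + j) := by
    refine hnil.isUnit_add_left_of_commute ?_ (Algebra.commutes a j).symm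
    exact (IsUnit.mk0 a ha0).map (algebraMap 𝕜 S)
  obtain ⟨u, hu⟩ := hu
  have : e i * s * e i = u * e i := by
    rw [hu, add_mul, hje, hj, Algebra.algebraMap_eq_smul_one, smul_mul_assoc, one_mul]
    abel
  exact ⟨↑u⁻¹, by rw [this, ← mul_assoc, Units.inv_mul, one_mul]⟩

/-- A nonzero projective module is not equal to `J P`: it has a vector `v` and a functional `f` with
`f v ∉ J`. -/
lemma exists_dual_not_mem {J : Submodule 𝕜 S} (hJ : IsNilpotent J) (P : Type*) [AddCommGroup P]
    [Module S P] [Module.Projective S P] [Nontrivial P] : ∃ (f : P →ₗ[S] S) (v : P), f v ∉ J := by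
  by_contra! H
  obtain ⟨s, hs⟩ := Module.projective_def.1 (inferInstance : Module.Projective S P)
  have expand (v : P) : v = ∑ x ∈ (s v).support, s v x • x := by
    conv_lhs => rw [← hs v, Finsupp.linearCombination_apply, Finsupp.sum]
    rfl
  have key (N : ℕ) : ∀ (f : P →ₗ[S] S) (v : P), f v ∈ J ^ (N + 1) := by
    induction N with
    | zero => simpa using H
    | succ N ih =>
      intro f v
      rw [expand v, map_sum, pow_succ']
      refine sum_mem fun x _ => ?_
      rw [map_smul, smul_eq_mul]
      exact Submodule.mul_mem_mul (H (Finsupp.lapply x ∘ₗ s) v) (ih f x)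
  obtain ⟨N, hN⟩ := hJ
  obtain ⟨v, hv⟩ := exists_ne (0 : P)
  apply hv
  rw [expand v]
  refine Finset.sum_eq_zero fun x _ => ?_
  have := key N (Finsupp.lapply x ∘ₗ s) v
  rw [pow_succ, hN, zero_mul] at this
  have : s v x = 0 := this
  rw [this, zero_smul]

lemma mem_fixedSubmodule {M : Type*} [AddCommGroup M] [Module S M] [Module 𝕜 M]
    [IsScalarTower 𝕜 S M] {e : S} {x : M} : x ∈ fixedSubmodule 𝕜 M e ↔ e • x = x := Iff.rfl

lemma mem_leftIdeal {e s : S} : s ∈ leftIdeal e ↔ s * e = s := Iff.rfl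

/-- A homomorphism from `S e` to a module `M` is determined by the image of `e`, an arbitrary
element of `e M`. -/
def leftIdealHomEquiv {e : S} (he : e * e = e) (M : Type*) [AddCommGroup M] [Module S M]
    [Module 𝕜 M] [IsScalarTower 𝕜 S M] : (leftIdeal e →ₗ[S] M) ≃ₗ[𝕜] fixedSubmodule 𝕜 M e where
  toFun f := ⟨f ⟨e, he⟩, by
    rw [mem_fixedSubmodule, ← map_smul]
    congr 1
    exact Subtype.ext he⟩
  map_add' f g := rfl
  map_smul' t f := rfl
  invFun x := (LinearMap.toSpanSingleton S M x) ∘ₗ (leftIdeal e).subtype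
  left_inv f := by
    ext ⟨s, hs⟩
    simp only [LinearMap.comp_apply, Submodule.subtype_apply, LinearMap.toSpanSingleton_apply]
    rw [← map_smul]
    congr 1
    exact Subtype.ext hs
  right_inv x := Subtype.ext x.2

lemma finrank_fixedSubmodule_leftIdeal (f e : S) :
    Module.finrank 𝕜 (fixedSubmodule 𝕜 (leftIdeal e) f) =
      Module.finrank 𝕜 (peirceComponent 𝕜 f e) := by
  refine LinearEquiv.finrank_eq (R := 𝕜)
    { toFun := fun x => ⟨x.1.1, congrArg Subtype.val x.2, x.1.2⟩
      invFun := fun x => ⟨⟨x.1, x.2.2⟩, Subtype.ext x.2.1⟩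
      map_add' := fun _ _ => rfl
      map_smul' := fun _ _ => rfl
      left_inv := fun _ => rfl
      right_inv := fun _ => rfl }

lemma projective_leftIdeal {e : S} (he : e * e = e) : Module.Projective S (leftIdeal e) :=
  .of_split (leftIdeal e).subtype
    ((LinearMap.toSpanSingleton S S e).codRestrict (leftIdeal e) fun s => by
      simp [mem_leftIdeal, mul_assoc, he])
    (by ext ⟨s, hs⟩; exact hs)

lemma finrank_fixedSubmodule_congr {M N : Type*} [AddCommGroup M] [Module S M] [Module 𝕜 M]
    [IsScalarTower 𝕜 S M] [AddCommGroup N] [Module S N] [Module 𝕜 N] [IsScalarTower 𝕜 S N]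
    (φ : M ≃ₗ[S] N) (e : S) :
    Module.finrank 𝕜 (fixedSubmodule 𝕜 M e) = Module.finrank 𝕜 (fixedSubmodule 𝕜 N e) := by
  refine LinearEquiv.finrank_eq (R := 𝕜)
    ((φ.restrictScalars 𝕜).submoduleMap (fixedSubmodule 𝕜 M e) ≪≫ₗ LinearEquiv.ofEq _ _ ?_)
  ext y
  constructor
  · rintro ⟨x, hx, rfl⟩
    change e • φ x = φ x
    rw [← map_smul, mem_fixedSubmodule.1 hx]
  · intro hy
    refine ⟨φ.symm y, ?_, φ.apply_symm_apply y⟩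
    change e • φ.symm y = φ.symm y
    rw [← map_smul, mem_fixedSubmodule.1 hy]

lemma finrank_fixedSubmodule_prod {M N : Type*} [AddCommGroup M] [Module S M] [Module 𝕜 M]
    [IsScalarTower 𝕜 S M] [AddCommGroup N] [Module S N] [Module 𝕜 N] [IsScalarTower 𝕜 S N]
    [Module.Finite 𝕜 M] [Module.Finite 𝕜 N] (e : S) :
    Module.finrank 𝕜 (fixedSubmodule 𝕜 (M × N) e) =
      Module.finrank 𝕜 (fixedSubmodule 𝕜 M e) + Module.finrank 𝕜 (fixedSubmodule 𝕜 N e) := by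
  rw [← Module.finrank_prod]
  refine LinearEquiv.finrank_eq (R := 𝕜)
    { toFun := fun x => (⟨x.1.1, congrArg Prod.fst x.2⟩, ⟨x.1.2, congrArg Prod.snd x.2⟩)
      invFun := fun x => ⟨(x.1.1, x.2.1), Prod.ext x.1.2 x.2.2⟩
      map_add' := fun _ _ => rfl
      map_smul' := fun _ _ => rfl
      left_inv := fun _ => rfl
      right_inv := fun _ => rfl }

/-- The decomposition of a module given by a split surjection. -/
def prodKerEquiv {P X : Type*} [AddCommGroup P] [Module S P] [AddCommGroup X] [Module S X]
    (g : P →ₗ[S] X) (s : X →ₗ[S] P) (h : g ∘ₗ s = LinearMap.id) :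
    P ≃ₗ[S] LinearMap.ker g × X where
  toFun p := (⟨p - s (g p), by
    have h (x) : g (s x) = x := LinearMap.congr_fun h x
    simp [h]⟩, g p)
  map_add' p q := by ext <;> simp; abel
  map_smul' r p := by ext <;> simp [smul_sub]
  invFun x := x.1 + s x.2
  left_inv p := by simp
  right_inv := by
    rintro ⟨⟨k, hk⟩, x⟩
    have h (x) : g (s x) = x := LinearMap.congr_fun h x
    have hk : g k = 0 := hk
    ext <;> simp [hk, h]

/-- A finitely generated projective module `P` over a finite-dimensional split basic algebra is a
sum of copies of the modules `S e_i`. This is expressed through the dimensions of `Hom(P, M)` and of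
`e_j P`, in terms of the multiplicities `r i`. -/
theorem IsSplitBasic.exists_multiplicity [Module.Finite 𝕜 S] {e : ι → S} {J : Submodule 𝕜 S}
    (h : IsSplitBasic 𝕜 e J) (N : ℕ) (P : Type v) [AddCommGroup P] [Module S P] [Module 𝕜 P]
    [IsScalarTower 𝕜 S P] [Module.Finite S P] [Module.Projective S P]
    (hN : Module.finrank 𝕜 P ≤ N) :
    ∃ r : ι → ℕ, (∀ (M : Type v) [AddCommGroup M] [Module S M] [Module 𝕜 M] [IsScalarTower 𝕜 S M]
      [Module.Finite 𝕜 M], Module.Finite 𝕜 (P →ₗ[S] M) ∧ Module.finrank 𝕜 (P →ₗ[S] M) =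
        ∑ i, r i * Module.finrank 𝕜 (fixedSubmodule 𝕜 M (e i))) ∧
      ∀ j, Module.finrank 𝕜 (fixedSubmodule 𝕜 P (e j)) =
        ∑ i, r i * Module.finrank 𝕜 (peirceComponent 𝕜 (e j) (e i)) := by
  have hP : Module.Finite 𝕜 P := Module.Finite.trans S P
  induction N generalizing P with
  | zero =>
    have := Module.finrank_zero_iff.1 (Nat.le_zero.1 hN)
    exact ⟨0, fun M _ _ _ _ _ => ⟨inferInstance, by simp [Module.finrank_zero_of_subsingleton]⟩,
      fun j => by simp [Module.finrank_zero_of_subsingleton]⟩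
  | succ N ih =>
    rcases subsingleton_or_nontrivial P with hPs | hPn
    · exact ⟨0, fun M _ _ _ _ _ => ⟨inferInstance, by simp [Module.finrank_zero_of_subsingleton]⟩,
        fun j => by simp [Module.finrank_zero_of_subsingleton]⟩
    obtain ⟨f, v, hfv⟩ := exists_dual_not_mem h.isNilpotent P
    obtain ⟨i, hi⟩ := h.exists_not_mem hfv
    obtain ⟨t, ht⟩ := h.exists_mul_eq hi
    -- the surjection `P → S e_i` splits off a copy of `S e_i`
    let g : P →ₗ[S] leftIdeal (e i) := (LinearMap.toSpanSingleton S S (e i) ∘ₗ f).codRestrict _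
      fun p => by simp [mem_leftIdeal, mul_assoc, h.mul_self]
    have hg : Function.Surjective g := fun s => ⟨((s : S) * t * e i) • v, Subtype.ext <| by
      have hs : (s : S) * e i = s := s.2
      calc f (((s : S) * t * e i) • v) * e i = s * (t * (e i * f v * e i)) := by
            simp [mul_assoc]
        _ = s := by rw [ht, hs]⟩
    have := projective_leftIdeal (h.mul_self i)
    obtain ⟨s, hs⟩ := Module.projective_lifting_property g LinearMap.id hg
    let φ := prodKerEquiv g s hs
    have : Module.Finite S (LinearMap.ker g) :=
      .of_surjective (LinearMap.fst S _ _ ∘ₗ φ.toLinearMap)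
        (Prod.fst_surjective.comp φ.surjective)
    have : Module.Projective S (LinearMap.ker g) :=
      .of_split (φ.symm.toLinearMap ∘ₗ LinearMap.inl S _ _) (LinearMap.fst S _ _ ∘ₗ φ.toLinearMap)
        (by ext; simp)
    have hk : Module.Finite 𝕜 (LinearMap.ker g) := Module.Finite.trans S _
    have he : Module.Finite 𝕜 (leftIdeal (e i)) :=
      .of_injective ((leftIdeal (e i)).subtype.restrictScalars 𝕜 : leftIdeal (e i) →ₗ[𝕜] S)
        Subtype.val_injective
    have hlt : Module.finrank 𝕜 (LinearMap.ker g) ≤ N := by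
      have h1 := (φ.restrictScalars 𝕜).finrank_eq
      have : Nontrivial (leftIdeal (e i)) := by
        refine ⟨⟨e i, h.mul_self i⟩, 0, fun h0 => hi ?_⟩
        have : e i = 0 := congrArg Subtype.val h0
        simp [this]
      have h2 : 0 < Module.finrank 𝕜 (leftIdeal (e i)) := Module.finrank_pos
      rw [Module.finrank_prod] at h1
      omega
    obtain ⟨r, hr, hr'⟩ := ih (LinearMap.ker g) hlt hk
    classical
    refine ⟨r + Pi.single i 1, fun M _ _ _ _ _ => ?_, fun j => ?_⟩
    · obtain ⟨hfin, hrM⟩ := hr M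
      let ψ : (P →ₗ[S] M) ≃ₗ[𝕜] (LinearMap.ker g →ₗ[S] M) × fixedSubmodule 𝕜 M (e i) :=
        LinearEquiv.congrLeft M 𝕜 φ ≪≫ₗ (LinearMap.coprodEquiv 𝕜).symm ≪≫ₗ
          (LinearEquiv.refl 𝕜 _).prodCongr (leftIdealHomEquiv (h.mul_self i) M)
      refine ⟨Module.Finite.equiv ψ.symm, ?_⟩
      rw [ψ.finrank_eq, Module.finrank_prod, hrM]
      simp [add_mul, Finset.sum_add_distrib, Pi.single_apply]
    · rw [finrank_fixedSubmodule_congr φ, finrank_fixedSubmodule_prod, hr' j,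
        finrank_fixedSubmodule_leftIdeal]
      simp [add_mul, Finset.sum_add_distrib, Pi.single_apply]

end

/-! ### Morphisms in the derived category and the Euler characteristic -/

section

open CochainComplex HomComplex DerivedCategory

variable {𝕜 : Type*} [Field 𝕜] {C : Type u} [Category.{v} C] [Abelian C] [Linear 𝕜 C]

lemma equivHomShift_symm_smul {K L : CochainComplex C ℤ} {n : ℤ} (t : 𝕜) (z : Cocycle K L n) :
    Cocycle.equivHomShift.symm (t • z) = t • Cocycle.equivHomShift.symm z := by
  ext p
  simp [Cocycle.equivHomShift_symm_apply, Cochain.rightShift_smul]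

lemma map_quotient_eq [HasDerivedCategory.{w} C] {K L : CochainComplex C ℤ} (f : K ⟶ L) :
    Q.map f = (quotientCompQhIso C).inv.app K ≫ Qh.map ((HomotopyCategory.quotient _ _).map f) ≫
      (quotientCompQhIso C).hom.app L := by
  have := (quotientCompQhIso C).hom.naturality f
  dsimp at this
  rw [this]
  simp

lemma Q_map_surjective [HasDerivedCategory.{w} C] (K L : CochainComplex C ℤ) [K.IsKProjective] :
    Function.Surjective (Q.map : (K ⟶ L) → _) := by
  intro g
  obtain ⟨f, hf⟩ := (IsKProjective.Qh_map_bijective _ _).surjective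
    ((quotientCompQhIso C).hom.app K ≫ g ≫ (quotientCompQhIso C).inv.app L)
  obtain ⟨f, rfl⟩ := (HomotopyCategory.quotient _ _).map_surjective f
  exact ⟨f, by rw [map_quotient_eq, hf]; simp⟩

lemma Q_map_eq_zero_iff [HasDerivedCategory.{w} C] {K L : CochainComplex C ℤ} [K.IsKProjective]
    (f : K ⟶ L) : Q.map f = 0 ↔ (HomotopyCategory.quotient _ _).map f = 0 := by
  refine ⟨fun h => (IsKProjective.Qh_map_bijective _ _).injective ?_, fun h => ?_⟩
  · rw [map_quotient_eq] at h
    rwa [Preadditive.IsIso.comp_left_eq_zero, Preadditive.IsIso.comp_right_eq_zero,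
      ← Functor.map_zero Qh] at h
  · rw [map_quotient_eq, h]
    simp

/-- The morphism `K ⟶ L[n]` of the derived category given by a cocycle of degree `n`. -/
def cocycleToHom (𝕜 : Type*) [Field 𝕜] [Linear 𝕜 C] [HasDerivedCategory.{w} C]
    (K L : CochainComplex C ℤ) (n : ℤ) :
    Cocycle K L n →ₗ[𝕜] (Q.obj K ⟶ (Q.obj L)⟦n⟧) where
  toFun z := Q.map (Cocycle.equivHomShift.symm z) ≫ (Q.commShiftIso n).hom.app L
  map_add' z z' := by simp
  map_smul' t z := by rw [equivHomShift_symm_smul, Functor.map_smul, Linear.smul_comp]; rfl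

lemma cocycleToHom_surjective [HasDerivedCategory.{w} C] (K L : CochainComplex C ℤ)
    [K.IsKProjective] (n : ℤ) : Function.Surjective (cocycleToHom 𝕜 K L n) := by
  intro g
  obtain ⟨f, hf⟩ := Q_map_surjective K (L⟦n⟧) (g ≫ (Q.commShiftIso n).inv.app L)
  refine ⟨Cocycle.equivHomShift f, ?_⟩
  simp [cocycleToHom, hf]

lemma cocycleToHom_eq_zero_iff [HasDerivedCategory.{w} C] {K L : CochainComplex C ℤ}
    [K.IsKProjective] {n : ℤ} (z : Cocycle K L n) :
    cocycleToHom 𝕜 K L n z = 0 ↔ ∃ y : Cochain K L (n - 1), δ (n - 1) n y = z := by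
  rw [← mem_coboundaries_iff z (n - 1) (by simp), ← CohomologyClass.toHom_mk_eq_zero_iff,
    CohomologyClass.toHom_mk, ← Q_map_eq_zero_iff]
  exact Preadditive.IsIso.comp_right_eq_zero _ _

/-- Cocycles as a subspace of the space of cochains. -/
def cocycleEquivKer (𝕜 : Type*) [Field 𝕜] [Linear 𝕜 C] (K L : CochainComplex C ℤ) (n : ℤ) :
    Cocycle K L n ≃ₗ[𝕜] LinearMap.ker (δ_hom 𝕜 K L n (n + 1)) where
  toFun z := ⟨z, z.δ_eq_zero (n + 1)⟩
  map_add' _ _ := rfl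
  map_smul' _ _ := rfl
  invFun z := Cocycle.mk z.1 (n + 1) rfl z.2
  left_inv _ := rfl
  right_inv _ := rfl

/-- A cochain on a complex concentrated in degrees `[a, b]` is a finite family of morphisms. -/
def cochainEquiv (𝕜 : Type*) [Field 𝕜] [Linear 𝕜 C] (K L : CochainComplex C ℤ) (n : ℤ) {a b : ℤ}
    [K.IsStrictlyGE a] [K.IsStrictlyLE b] :
    Cochain K L n ≃ₗ[𝕜] ∀ p : Finset.Icc a b, (K.X p ⟶ L.X (p + n)) :=
  LinearEquiv.ofBijective
    { toFun := fun z p => z.v p (p + n) rfl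
      map_add' := fun _ _ => rfl
      map_smul' := fun _ _ => funext fun _ => Cochain.smul_v _ _ _ _ _ } <| by
    constructor
    · intro z z' h
      ext p q rfl
      by_cases hp : p ∈ Finset.Icc a b
      · exact congrFun h ⟨p, hp⟩
      · refine Limits.IsZero.eq_of_src ?_ _ _
        rw [Finset.mem_Icc, not_and_or, not_le, not_le] at hp
        rcases hp with hp | hp
        · exact K.isZero_of_isStrictlyGE a p hp
        · exact K.isZero_of_isStrictlyLE b p hp
    · intro f
      refine ⟨Cochain.mk fun p q hpq => if h : p ∈ Finset.Icc a b then
        f ⟨p, h⟩ ≫ (L.XIsoOfEq hpq).hom else 0, ?_⟩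
      ext p
      change (if h : p.1 ∈ Finset.Icc a b then f ⟨p.1, h⟩ ≫ (L.XIsoOfEq rfl).hom else 0) = f p
      rw [dif_pos p.2]
      simp

/-- The Euler characteristic of a complex with terms of dimension `c n`, spaces of cocycles and
coboundaries of dimensions `z n` and `b n`, and cohomology of dimension `h n`. -/
lemma finsum_negOnePow_eq {c z b h : ℤ → ℕ} (hc : ∀ n, z n + b (n + 1) = c n)
    (hz : ∀ n, h n + b n = z n) (hfin : (Function.support c).Finite) :
    ∑ᶠ n : ℤ, (n.negOnePow : ℤ) * (h n : ℤ) = ∑ᶠ n : ℤ, (n.negOnePow : ℤ) * (c n : ℤ) := by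
  have hb : (Function.support fun n : ℤ => (n.negOnePow : ℤ) * (b n : ℤ)).Finite := by
    refine hfin.subset fun n hn => ?_
    have : b n ≠ 0 := fun h0 => hn (by simp [h0])
    have := hc n
    have := hz n
    rw [Function.mem_support]
    omega
  have hh : (Function.support fun n : ℤ => (n.negOnePow : ℤ) * (h n : ℤ)).Finite := by
    refine hfin.subset fun n hn => ?_
    have : h n ≠ 0 := fun h0 => hn (by simp [h0])
    have := hc n
    have := hz n
    rw [Function.mem_support]
    omega
  have hb' : (Function.support fun n : ℤ => ((n + 1).negOnePow : ℤ) * (b (n + 1) : ℤ)).Finite :=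
    hb.preimage (add_left_injective 1).injOn
  have e : ∀ n : ℤ, (n.negOnePow : ℤ) * (c n : ℤ) = ((n.negOnePow : ℤ) * (h n : ℤ) +
      (n.negOnePow : ℤ) * (b n : ℤ)) - ((n + 1).negOnePow : ℤ) * (b (n + 1) : ℤ) := by
    intro n
    rw [← hc, ← hz, Int.negOnePow_succ]
    push_cast
    ring
  have hshift : ∑ᶠ n : ℤ, ((n + 1).negOnePow : ℤ) * (b (n + 1) : ℤ) =
      ∑ᶠ n : ℤ, (n.negOnePow : ℤ) * (b n : ℤ) :=
    finsum_comp_equiv (Equiv.addRight (1 : ℤ)) (f := fun n : ℤ => (n.negOnePow : ℤ) * (b n : ℤ))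
  simp_rw [e]
  rw [finsum_sub_distrib ?_ hb', finsum_add_distrib hh hb, hshift, add_sub_cancel_right]
  exact (hh.union hb).subset (Function.support_add _ _)

/-- Total Hom spaces and Euler form of bounded complexes of projective objects with
finite-dimensional spaces of morphisms. -/
theorem eulerChar_Q_obj [HasDerivedCategory.{w} C] (K L : CochainComplex C ℤ) {a b : ℤ}
    [K.IsStrictlyGE a] [K.IsStrictlyLE b] [L.IsStrictlyGE a] [L.IsStrictlyLE b]
    (hK : ∀ p, Projective (K.X p)) (hfin : ∀ p q, Module.Finite 𝕜 (K.X p ⟶ L.X q)) :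
    FiniteTotalHom 𝕜 (Q.obj K) (Q.obj L) ∧ eulerChar 𝕜 (Q.obj K) (Q.obj L) =
      ∑ p ∈ Finset.Icc a b, ∑ q ∈ Finset.Icc a b,
        (p.negOnePow : ℤ) * (q.negOnePow : ℤ) * (Module.finrank 𝕜 (K.X p ⟶ L.X q) : ℤ) := by
  have := CochainComplex.isKProjective_of_projective K b
  have hcoch (n : ℤ) : Module.Finite 𝕜 (Cochain K L n) :=
    Module.Finite.equiv (cochainEquiv 𝕜 K L n (a := a) (b := b)).symm
  have hcoc (n : ℤ) : Module.Finite 𝕜 (Cocycle K L n) :=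
    Module.Finite.equiv (cocycleEquivKer 𝕜 K L n).symm
  have hhom (n : ℤ) : Module.Finite 𝕜 (Q.obj K ⟶ (Q.obj L)⟦n⟧) :=
    Module.Finite.of_surjective _ (cocycleToHom_surjective K L n)
  have hzero (p q : ℤ) (hq : q ∉ Finset.Icc a b) : Module.finrank 𝕜 (K.X p ⟶ L.X q) = 0 := by
    have : Subsingleton (K.X p ⟶ L.X q) := by
      refine ⟨fun f g => Limits.IsZero.eq_of_tgt ?_ f g⟩
      rw [Finset.mem_Icc, not_and_or, not_le, not_le] at hq
      rcases hq with hq | hq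
      · exact L.isZero_of_isStrictlyGE a q hq
      · exact L.isZero_of_isStrictlyLE b q hq
    exact Module.finrank_zero_of_subsingleton
  have hc (n : ℤ) : Module.finrank 𝕜 (Cochain K L n) =
      ∑ p ∈ Finset.Icc a b, Module.finrank 𝕜 (K.X p ⟶ L.X (p + n)) := by
    rw [(cochainEquiv 𝕜 K L n (a := a) (b := b)).finrank_eq, Module.finrank_pi_fintype]
    exact Finset.sum_coe_sort (Finset.Icc a b) fun p => Module.finrank 𝕜 (K.X p ⟶ L.X (p + n))
  have hsupp : (Function.support fun n => Module.finrank 𝕜 (Cochain K L n)).Finite := by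
    refine (Set.finite_Icc (a - b) (b - a)).subset fun n hn => ?_
    by_contra hn'
    refine hn ?_
    change Module.finrank 𝕜 (Cochain K L n) = 0
    rw [hc]
    refine Finset.sum_eq_zero fun p hp => hzero _ _ fun hq => hn' ?_
    rw [Finset.mem_Icc] at hp hq
    exact ⟨by linarith, by linarith⟩
  have hz (n : ℤ) : Module.finrank 𝕜 (LinearMap.ker (δ_hom 𝕜 K L n (n + 1))) +
      Module.finrank 𝕜 (LinearMap.range (δ_hom 𝕜 K L (n + 1 - 1) (n + 1))) =
      Module.finrank 𝕜 (Cochain K L n) := by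
    rw [add_comm, add_sub_cancel_right, (δ_hom 𝕜 K L n (n + 1)).finrank_range_add_finrank_ker]
  have hh (n : ℤ) : Module.finrank 𝕜 (Q.obj K ⟶ (Q.obj L)⟦n⟧) +
      Module.finrank 𝕜 (LinearMap.range (δ_hom 𝕜 K L (n - 1) n)) =
      Module.finrank 𝕜 (LinearMap.ker (δ_hom 𝕜 K L n (n + 1))) := by
    rw [← (cocycleEquivKer 𝕜 K L n).finrank_eq,
      ← (cocycleToHom 𝕜 K L n).finrank_range_add_finrank_ker,
      LinearMap.range_eq_top.2 (cocycleToHom_surjective K L n), finrank_top]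
    congr 1
    let κ : LinearMap.ker (cocycleToHom 𝕜 K L n) →ₗ[𝕜]
        LinearMap.range (δ_hom 𝕜 K L (n - 1) n) :=
      { toFun := fun z => ⟨(z.1 : Cochain K L n), (cocycleToHom_eq_zero_iff (𝕜 := 𝕜) z.1).1 z.2⟩
        map_add' := fun _ _ => rfl
        map_smul' := fun _ _ => rfl }
    refine (LinearEquiv.finrank_eq (R := 𝕜)
      (LinearEquiv.ofBijective κ ⟨fun z z' h => ?_, ?_⟩)).symm
    · have h' : (z.1 : Cochain K L n) = z'.1 := by
        have h0 := congrArg Subtype.val h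
        exact h0
      exact Subtype.ext (Cocycle.ext h')
    · rintro ⟨_, y, rfl⟩
      exact ⟨⟨Cocycle.mk (δ (n - 1) n y) (n + 1) rfl (δ_δ _ _ _ _),
        (cocycleToHom_eq_zero_iff (𝕜 := 𝕜) _).2 ⟨y, rfl⟩⟩, rfl⟩
  refine ⟨⟨hhom, hsupp.subset fun n hn => ?_⟩, ?_⟩
  · have hn : Nontrivial (Q.obj K ⟶ (Q.obj L)⟦n⟧) := hn
    have h1 : 0 < Module.finrank 𝕜 (Q.obj K ⟶ (Q.obj L)⟦n⟧) := Module.finrank_pos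
    have h2 := hz n
    have h3 := hh n
    rw [Function.mem_support]
    omega
  · rw [eulerChar, finsum_negOnePow_eq hz hh hsupp]
    simp_rw [hc]
    push_cast
    simp_rw [Finset.mul_sum]
    have hp (p : ℤ) : (Function.support fun n : ℤ =>
        (n.negOnePow : ℤ) * (Module.finrank 𝕜 (K.X p ⟶ L.X (p + n)) : ℤ)) ⊆
        Finset.Icc (a - p) (b - p) := by
      intro n hn
      by_contra hn'
      refine hn ?_
      simp only [Finset.coe_Icc, Set.mem_Icc] at hn'
      simp [hzero p (p + n) (by rw [Finset.mem_Icc]; omega)]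
    rw [finsum_sum_comm _ _ fun p _ => (Finset.finite_toSet _).subset (hp p)]
    refine Finset.sum_congr rfl fun p _ => ?_
    rw [finsum_eq_sum_of_support_subset _ (hp p)]
    refine Finset.sum_bij' (fun n _ => p + n) (fun q _ => q - p) ?_ ?_ ?_ ?_ ?_
    · intro n hn
      rw [Finset.mem_Icc] at hn ⊢
      omega
    · intro q hq
      rw [Finset.mem_Icc] at hq ⊢
      omega
    · simp
    · simp
    · intro n _
      rw [Int.negOnePow_add, Units.val_mul, ← mul_assoc, ← Units.val_mul, Int.units_mul_self]
      simp

lemma FiniteTotalHom.of_iso {T : Type*} [Category* T] [Preadditive T] [Linear 𝕜 T] [HasShift T ℤ]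
    {E F : T} (i : E ≅ F) (h : FiniteTotalHom 𝕜 F F) : FiniteTotalHom 𝕜 E E := by
  have e (l : ℤ) : (E ⟶ E⟦l⟧) ≃ₗ[𝕜] (F ⟶ F⟦l⟧) :=
    Linear.homCongr 𝕜 i ((CategoryTheory.shiftFunctor T l).mapIso i)
  refine ⟨fun l => ?_, h.2.subset fun l hl => ?_⟩
  · have := h.1 l
    exact Module.Finite.equiv (e l).symm
  · have : Nontrivial (E ⟶ E⟦l⟧) := hl
    exact (e l).symm.toEquiv.nontrivial

lemma eulerChar_congr {T : Type*} [Category* T] [Preadditive T] [Linear 𝕜 T] [HasShift T ℤ]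
    {E F : T} (i : E ≅ F) : eulerChar 𝕜 E E = eulerChar 𝕜 F F := by
  refine finsum_congr fun l => ?_
  rw [(Linear.homCongr 𝕜 i ((CategoryTheory.shiftFunctor T l).mapIso i)).finrank_eq]

/-- The Euler form takes the value `1` on exceptional objects. -/
lemma IsExceptional.eulerChar_eq_one {T : Type*} [Category* T] [Preadditive T] [Linear 𝕜 T]
    [HasShift T ℤ] {E : T} (h : IsExceptional 𝕜 E) : eulerChar 𝕜 E E = 1 := by
  rw [eulerChar, finsum_eq_single _ 0]
  · have e : (E ⟶ E⟦(0 : ℤ)⟧) ≃ₗ[𝕜] (E ⟶ E) :=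
      Linear.homCongr 𝕜 (Iso.refl E) ((shiftFunctorZero T ℤ).app E)
    rw [e.finrank_eq, h.2]
    simp
  · intro l hl
    have := h.1 l hl
    rw [Module.finrank_zero_of_subsingleton]
    simp

end

/-! ### Perfect complexes over `R_F` -/

namespace TwoVertex

namespace RF

variable {𝕜 : Type u} [Field 𝕜] {n m : ℕ} (V W : Fin m → Submodule 𝕜 (Fin n → 𝕜))

/-- The idempotents of the two vertices, in the opposite algebra (right `R_F`-modules are left
modules over the opposite algebra). -/
def idempotent : Fin 2 → (RF V W)ᵐᵒᵖ := ![.op (e1 V W), .op (e2 V W)]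

/-- The span of the paths of positive length, in the opposite algebra. -/
def radicalOp : Submodule 𝕜 (RF V W)ᵐᵒᵖ :=
  (radical V W).map (MulOpposite.opLinearEquiv 𝕜 : RF V W ≃ₗ[𝕜] (RF V W)ᵐᵒᵖ).toLinearMap

lemma isSplitBasic : IsSplitBasic 𝕜 (idempotent V W) (radicalOp V W) where
  mul_self i := by
    fin_cases i
    · exact congrArg MulOpposite.op (e1_mul_e1 V W)
    · exact congrArg MulOpposite.op (e2_mul_e2 V W)
  sum_eq_one := by
    rw [Fin.sum_univ_two]
    exact congrArg MulOpposite.op (e1_add_e2 V W)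
  isNilpotent := by
    refine ⟨4, ?_⟩
    have := Submodule.map_op_pow (radical V W) 4
    rw [radical_pow_four] at this
    refine this.symm.trans ?_
    exact Submodule.map_bot _
  diag i s := by
    fin_cases i
    · obtain ⟨a, ha⟩ := e1_mul_e1_mem V W s.unop
      refine ⟨a, _, ha, ?_⟩
      rw [mul_assoc]
      rfl
    · obtain ⟨a, ha⟩ := e2_mul_e2_mem V W s.unop
      refine ⟨a, _, ha, ?_⟩
      rw [mul_assoc]
      rfl
  offDiag i j h s := by
    fin_cases i <;> fin_cases j
    · exact absurd rfl h
    · refine ⟨_, e2_mul_e1_mem V W s.unop, ?_⟩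
      rw [mul_assoc]
      rfl
    · refine ⟨_, e1_mul_e2_mem V W s.unop, ?_⟩
      rw [mul_assoc]
      rfl
    · exact absurd rfl h

lemma finrank_peirceComponent_op (e f : RF V W) :
    Module.finrank 𝕜 (peirceComponent 𝕜 (MulOpposite.op f) (MulOpposite.op e)) =
      Module.finrank 𝕜 (peirceComponent 𝕜 e f) :=
  LinearEquiv.finrank_eq (R := 𝕜)
    { toFun := fun x => ⟨x.1.unop, congrArg MulOpposite.unop x.2.2, congrArg MulOpposite.unop x.2.1⟩
      invFun := fun x => ⟨.op x.1, congrArg MulOpposite.op x.2.2, congrArg MulOpposite.op x.2.1⟩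
      map_add' := fun _ _ => rfl
      map_smul' := fun _ _ => rfl
      left_inv := fun _ => rfl
      right_inv := fun _ => rfl }

open scoped ModuleCat in
/-- Dimensions of spaces of morphisms between finitely generated projective modules, in terms of the
multiplicities of the two indecomposable projective modules. -/
lemma exists_multiplicity (P : RightMod (RF V W)) [Module.Finite (RF V W)ᵐᵒᵖ P]
    [Module.Projective (RF V W)ᵐᵒᵖ P] : ∃ r : Fin 2 → ℕ,
      (∀ M : RightMod (RF V W), Module.Finite (RF V W)ᵐᵒᵖ M →
        Module.Finite 𝕜 (P ⟶ M) ∧ Module.finrank 𝕜 (P ⟶ M) =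
        ∑ i, r i * Module.finrank 𝕜 (fixedSubmodule 𝕜 M (idempotent V W i))) ∧
      ∀ j, Module.finrank 𝕜 (fixedSubmodule 𝕜 P (idempotent V W j)) =
        ∑ i, r i * Module.finrank 𝕜
          (peirceComponent 𝕜 (idempotent V W j) (idempotent V W i)) := by
  have : Module.Finite 𝕜 (RF V W) := finite_RF V W
  have : Module.Finite 𝕜 (RF V W)ᵐᵒᵖ := Module.Finite.equiv (MulOpposite.opLinearEquiv 𝕜)
  obtain ⟨r, hr, hr'⟩ := (isSplitBasic V W).exists_multiplicity _ P le_rfl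
  refine ⟨r, fun M hM => ?_, hr'⟩
  have : Module.Finite 𝕜 M := Module.Finite.trans (RF V W)ᵐᵒᵖ M
  obtain ⟨h1, h2⟩ := hr M
  let φ : (P ⟶ M) ≃ₗ[𝕜] (P →ₗ[(RF V W)ᵐᵒᵖ] M) :=
    { ModuleCat.homAddEquiv with map_smul' := fun _ _ => rfl }
  exact ⟨Module.Finite.equiv φ.symm, by rw [φ.finrank_eq, h2]⟩

/-- The dimensions of the Peirce components of `R_F`. -/
lemma finrank_peirceComponent {k : ℕ} (hkn : k < n) (hV : ∀ i, Module.finrank 𝕜 (V i) = k)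
    (hW : ∀ i, Module.finrank 𝕜 ((Fin n → 𝕜) ⧸ W i) = k) :
    Module.finrank 𝕜 (peirceComponent 𝕜 (e1 V W) (e1 V W)) = 1 + m * (n - k) ∧
    Module.finrank 𝕜 (peirceComponent 𝕜 (e2 V W) (e1 V W)) = n + m * (k * (n - k)) ∧
    Module.finrank 𝕜 (peirceComponent 𝕜 (e1 V W) (e2 V W)) = m ∧
    Module.finrank 𝕜 (peirceComponent 𝕜 (e2 V W) (e2 V W)) = 1 + m * k := by
  have hV' (i) : Module.finrank 𝕜 ((Fin n → 𝕜) ⧸ V i) = n - k := by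
    have := (V i).finrank_quotient_add_finrank
    rw [hV, Module.finrank_fin_fun] at this
    omega
  refine ⟨?_, ?_, ?_, ?_⟩
  · rw [(finrank_peirceComponent_e1 V W).1]
    simp [Module.finrank_prod, Module.finrank_pi_fintype, hV']
  · rw [(finrank_peirceComponent_e1 V W).2.1]
    simp [Module.finrank_prod, Module.finrank_pi_fintype, Module.finrank_tensorProduct, hV', hW]
  · rw [(finrank_peirceComponent_e2 V W).1]
    simp
  · rw [(finrank_peirceComponent_e2 V W).2.1]
    simp [Module.finrank_prod, Module.finrank_pi_fintype, hW]

lemma finrank_peirceComponent_idempotent {k : ℕ} (hkn : k < n)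
    (hV : ∀ i, Module.finrank 𝕜 (V i) = k)
    (hW : ∀ i, Module.finrank 𝕜 ((Fin n → 𝕜) ⧸ W i) = k) :
    Module.finrank 𝕜 (peirceComponent 𝕜 (idempotent V W 0) (idempotent V W 0)) =
      1 + m * (n - k) ∧
    Module.finrank 𝕜 (peirceComponent 𝕜 (idempotent V W 0) (idempotent V W 1)) =
      n + m * (k * (n - k)) ∧
    Module.finrank 𝕜 (peirceComponent 𝕜 (idempotent V W 1) (idempotent V W 0)) = m ∧
    Module.finrank 𝕜 (peirceComponent 𝕜 (idempotent V W 1) (idempotent V W 1)) = 1 + m * k := by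
  obtain ⟨d11, d21, d12, d22⟩ := finrank_peirceComponent V W hkn hV hW
  exact ⟨(finrank_peirceComponent_op V W _ _).trans d11,
    (finrank_peirceComponent_op V W _ _).trans d21,
    (finrank_peirceComponent_op V W _ _).trans d12,
    (finrank_peirceComponent_op V W _ _).trans d22⟩

end RF

end TwoVertex

/-- The Euler form on `perf R_F`: the integers `x` and `y` are the alternating sums of the
multiplicities of the two indecomposable projective modules in a complex representing `E`. -/
theorem eulerChar_perf {𝕜 : Type u} [Field 𝕜] {n m k : ℕ} (hkn : k < n)
    (V W : Fin m → Submodule 𝕜 (Fin n → 𝕜))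
    (hV : ∀ i, Module.finrank 𝕜 (V i) = k)
    (hW : ∀ i, Module.finrank 𝕜 ((Fin n → 𝕜) ⧸ W i) = k)
    [HasDerivedCategory.{w} (RightMod (TwoVertex.RF V W))]
    (E : DerivedCategory (RightMod (TwoVertex.RF V W))) (hE : perf (TwoVertex.RF V W) E) :
    FiniteTotalHom 𝕜 E E ∧ ∃ x y : ℤ, eulerChar 𝕜 E E =
      (1 + m * (n - k)) * x ^ 2 + (m + (n + m * (k * (n - k)))) * (x * y) +
        (1 + m * k) * y ^ 2 := by
  obtain ⟨K, ⟨a, b, hGE, hLE⟩, hK, ⟨i⟩⟩ := hE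
  have hfin (p) := (hK p).1
  have hproj (p) := (hK p).2
  choose r hr hr' using fun p => TwoVertex.RF.exists_multiplicity V W (K.X p)
  obtain ⟨h1, h2⟩ := eulerChar_Q_obj (𝕜 := 𝕜) K K (a := a) (b := b)
    (fun p => (IsProjective.iff_projective _).1 (hproj p)) (fun p q => (hr p _ (hfin q)).1)
  refine ⟨h1.of_iso i, ∑ p ∈ Finset.Icc a b, (p.negOnePow : ℤ) * r p 0,
    ∑ p ∈ Finset.Icc a b, (p.negOnePow : ℤ) * r p 1, ?_⟩
  obtain ⟨d11, d12, d21, d22⟩ := TwoVertex.RF.finrank_peirceComponent_idempotent V W hkn hV hW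
  rw [eulerChar_congr i, h2]
  have hpq (p q : ℤ) : (Module.finrank 𝕜 (K.X p ⟶ K.X q) : ℤ) =
      r p 0 * (r q 0 * (1 + m * (n - k)) + r q 1 * (n + m * (k * (n - k)))) +
      r p 1 * (r q 0 * m + r q 1 * (1 + m * k)) := by
    rw [(hr p _ (hfin q)).2]
    simp only [Fin.sum_univ_two, hr', d11, d12, d21, d22]
    push_cast [Nat.cast_sub hkn.le]
    ring
  simp_rw [hpq]
  have expand (f g : ℤ → ℤ) : (∑ p ∈ Finset.Icc a b, (p.negOnePow : ℤ) * f p) *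
      (∑ p ∈ Finset.Icc a b, (p.negOnePow : ℤ) * g p) = ∑ p ∈ Finset.Icc a b, ∑ q ∈ Finset.Icc a b,
        (p.negOnePow : ℤ) * (q.negOnePow : ℤ) * (f p * g q) := by
    rw [Finset.sum_mul_sum]
    exact Finset.sum_congr rfl fun p _ => Finset.sum_congr rfl fun q _ => by ring
  set X := ∑ p ∈ Finset.Icc a b, (p.negOnePow : ℤ) * r p 0 with hX
  set Y := ∑ p ∈ Finset.Icc a b, (p.negOnePow : ℤ) * r p 1 with hY
  have e : (1 + m * (n - k)) * X ^ 2 + (m + (n + m * (k * (n - k)))) * (X * Y) +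
      (1 + m * k) * Y ^ 2 = (1 + m * (n - k)) * (X * X) + (n + m * (k * (n - k))) * (X * Y) +
        m * (Y * X) + (1 + m * k) * (Y * Y) := by ring
  rw [e, hX, hY, expand, expand, expand, expand]
  simp only [Finset.mul_sum, ← Finset.sum_add_distrib]
  exact Finset.sum_congr rfl fun p _ => Finset.sum_congr rfl fun q _ => by ring

end

theorem mainTheorem5 {𝕜 : Type u} [Field 𝕜] {n m k : ℕ} (hm : 1 ≤ m) (hk : 1 ≤ k) (hkn : k < n)
    (V W : Fin m → Submodule 𝕜 (Fin n → 𝕜))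
    (hV : ∀ i, Module.finrank 𝕜 (V i) = k)
    (hW : ∀ i, Module.finrank 𝕜 ((Fin n → 𝕜) ⧸ W i) = k)
    [HasDerivedCategory.{w} (RightMod (TwoVertex.RF V W))] :
    (∀ E : DerivedCategory (RightMod (TwoVertex.RF V W)),
      perf (TwoVertex.RF V W) E → ¬ IsExceptional 𝕜 E) ∧
    (∀ E : DerivedCategory (RightMod (TwoVertex.RF V W)),
      perf (TwoVertex.RF V W) E → FiniteTotalHom 𝕜 E E ∧ eulerChar 𝕜 E E ≠ 1) := by
  have main : ∀ E : DerivedCategory (RightMod (TwoVertex.RF V W)),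
      perf (TwoVertex.RF V W) E → FiniteTotalHom 𝕜 E E ∧ eulerChar 𝕜 E E ≠ 1 := by
    intro E hE
    obtain ⟨h, x, y, hxy⟩ := eulerChar_perf hkn V W hV hW E hE
    refine ⟨h, fun h1 => form_ne_one (m := m) (p := n - k) (q := k) (by omega) (by omega)
      (by omega) x y (Eq.trans ?_ (hxy.symm.trans h1))⟩
    ring
  exact ⟨fun E hE hex => (main E hE).2 hex.eulerChar_eq_one, main⟩
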